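/- \textbf{Setting.} Let $d\ge 1$ and let $\ell:[0,\infty)\to[0,\infty]$ satisfy: (H1) $\ell\ge 0$ and $\ell(0)>0$; (H2) $\ell$ is lower semicontinuous; (H3) $\lim_{r\to\infty}\ell(r)=0$. Let $\mathcal M$ be the space of finite signed Borel measures on $\mathbb R^d$, paired with $C_0(\mathbb R^d)$ (continuous functions vanishing at infinity) by $\langle v,\rho\rangle=\int v\,d\rho$, and write $\rho_n\rightharpoonup\rho$ for weak* convergence. Let $\mathcal P$ and $\mathcal P_-$ be the sets of non-negative $\rho\in\mathcal M$ with mass $\|\rho\|=\rho(\mathbb R^d)$ equal to $1$, respectively at most $1$. For $N\ge 1$ let $c_N(x_1,\dots,x_N)=\frac{2}{N(N-1)}\sum_{1\le i<j\le N}\ell(|x_i-x_j|)$ (with $c_1=0$). For $\rho\in\mathcal P$ let $C_N(\rho)=\inf\int c_N\,dP$, the infimum being over all probabilities $P$ on $(\mathbb R^d)^N$ whose $N$ marginals all equal $\rho$; let $C_N(\rho)=+\infty$ for $\rho\in\mathcal M\setminus\mathcal P$. Let $$\overline{C_N}(\rho)=\inf\Big\{\liminf_n C_N(\rho_n)\;:\;\rho_n\in\mathcal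 P,\ \rho_n\rightharpoonup\rho\Big\}\quad(\inf\emptyset=+\infty).$$ For $F:\mathcal M\to(-\infty,+\infty]$ put $F^*(v)=\sup_{\rho\in\mathcal M}\{\langle v,\rho\rangle-F(\rho)\}$ for $v\in C_0(\mathbb R^d)$ and $F^{**}(\rho)=\sup_{v\in C_0(\mathbb R^d)}\{\langle v,\rho\rangle-F^*(v)\}$ for $\rho\in\mathcal M$. Let $M_N=C_N^*$, $$M_\infty(v)=\lim_{N\to\infty}M_N(v),\qquad C_\infty(\rho)=\lim_{N\to\infty}\overline{C_N}(\rho).$$ Let $D(\rho)=\iint\ell(|x-y|)\,d\rho(x)\,d\rho(y)$ if $\rho\in\mathcal P$ and $D(\rho)=+\infty$ otherwise. Let $D_2(\rho)=\|\rho\|^2D(\rho/\|\rho\|)$ if $\rho\in\mathcal P_-$ (so $D_2(0)=0$) and $D_2(\rho)=+\infty$ otherwise. Let $\overline D(\rho)=\inf\{\liminf_n D(\rho_n):\rho_n\rightharpoonup\rho\}$ be the weak* lower semicontinuous envelope of $D$. \textbf{Theorem.} The limits defining $M_\infty(v)$ and $C_\infty(\rho)$ exist for all $v\in C_0(\mathbb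 R^d)$ and $\rho\in\mathcal M$, and the following hold. (i) If $D\not\equiv+\infty$, then $M_\infty=D^*$; hence, for every $v\in C_0(\mathbb R^d)$, $$M_\infty(v)=\sup_{\rho\in\mathcal P}\iint\Big(\frac{v(x)+v(y)}2-\ell(|x-y|)\Big)\,d\rho(x)\,d\rho(y).$$ If $\ell$ is bounded (in which case automatically $D\not\equiv+\infty$), then for all $v\in C_0(\mathbb R^d)$ and $N\ge1$, with $v_+=\max(v,0)$, $$M_\infty(v)\le M_N(v)\le M_\infty(v)+\frac1N\big(\sup\ell+\sup v_+\big).$$ (ii) $C_\infty=D_2^{**}$ on $\mathcal M$, and if $D\not\equiv+\infty$ then also $C_\infty=D^{**}$ on $\mathcal M$. If $D$ is convex, then $C_\infty(\rho)=D(\rho)$ for every $\rho\in\mathcal P$, and, provided $D\not\equiv+\infty$, $C_\infty=\overline D$ on $\mathcal M$. If $D_2$ is convex, then $C_\infty=D_2$ on $\mathcal M$. -/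

import Mathlib

open MeasureTheory Filter Topology
open scoped NNReal ENNReal ZeroAtInfty

noncomputable section

namespace MultiMarginal

/-- The Euclidean space `ℝᵈ`. -/
abbrev Space (d : ℕ) : Type := EuclideanSpace ℝ (Fin d)

/-- The finite signed Borel measures on `ℝᵈ`, i.e. the dual of `C₀(ℝᵈ)`. -/
abbrev Meas (d : ℕ) : Type := SignedMeasure (Space d)

/-- The standing assumptions on a cost `ℓ : [0, ∞) → [0, ∞]`. Non-negativity is part of the type. -/
structure StandingAssumptions (ℓ : ℝ≥0 → ℝ≥0∞) : Prop where
  pos_zero : 0 < ℓ 0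
  lsc : LowerSemicontinuous ℓ
  tendsto_zero : Tendsto ℓ atTop (𝓝 0)

variable {d : ℕ}

/-- `μ` is a probability measure. -/
def IsProb (μ : Meas d) : Prop := 0 ≤ μ ∧ μ Set.univ = 1

/-- `μ` is a sub-probability measure: it is non-negative and its mass is at most `1`. -/
def IsSubProb (μ : Meas d) : Prop := 0 ≤ μ ∧ μ Set.univ ≤ 1

/-- The pairing `⟨v, μ⟩ = ∫ v dμ` between `C₀(ℝᵈ)` and the finite signed measures. -/
def pairing (v : C₀(Space d, ℝ)) (μ : Meas d) : ℝ := ∫ᵛ x, v x ∂<•μ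

/-- Weak* convergence of a sequence of measures. -/
def WeakStarTendsto (μs : ℕ → Meas d) (μ : Meas d) : Prop :=
  ∀ v : C₀(Space d, ℝ), Tendsto (fun n => pairing v (μs n)) atTop (𝓝 (pairing v μ))

/-- Legendre-Fenchel conjugate, on `C₀(ℝᵈ)`, of a functional on measures. -/
def conj (F : Meas d → EReal) (v : C₀(Space d, ℝ)) : EReal :=
  ⨆ μ : Meas d, ((pairing v μ : ℝ) : EReal) - F μ

/-- Legendre-Fenchel conjugate, on measures, of a functional on `C₀(ℝᵈ)`. -/
def dualConj (G : C₀(Space d, ℝ) → EReal) (μ : Meas d) : EReal :=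
  ⨆ v : C₀(Space d, ℝ), ((pairing v μ : ℝ) : EReal) - G v

/-- The biconjugate of a functional on measures. -/
def biconj (F : Meas d → EReal) : Meas d → EReal := dualConj (conj F)

/-- Convexity of an extended real valued functional on measures: its epigraph is convex. -/
def IsConvex (F : Meas d → EReal) : Prop :=
  Convex ℝ {p : Meas d × ℝ | F p.1 ≤ (p.2 : EReal)}

/-- The `N`-particle cost `c_N(x₁, …, x_N) = 2 / (N (N - 1)) * ∑_{i < j} ℓ(|x_i - x_j|)`.
For `N = 1` the sum is empty and `c_1 = 0`. -/
def cost (ℓ : ℝ≥0 → ℝ≥0∞) (N : ℕ) (x : Fin N → Space d) : ℝ≥0∞ :=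
  2 / ((N * (N - 1) : ℕ) : ℝ≥0∞) * ∑ i : Fin N, ∑ j ∈ Finset.Ioi i, ℓ ‖x i - x j‖₊

/-- The transport plans `P ∈ 𝒫((ℝᵈ)ᴺ)` all of whose marginals are `ρ`. -/
def plans (N : ℕ) (ρ : Measure (Space d)) : Set (Measure (Fin N → Space d)) :=
  {P | IsProbabilityMeasure P ∧ ∀ j : Fin N, P.map (fun x => x j) = ρ}

open Classical in
/-- The multi-marginal optimal transport cost `C_N`, extended by `+∞` outside the probabilities.
For `μ ≥ 0` the total variation `μ.variation` is `μ` itself, as a Mathlib `Measure`. -/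
def CN (ℓ : ℝ≥0 → ℝ≥0∞) (N : ℕ) (μ : Meas d) : EReal :=
  if IsProb μ then ((⨅ P ∈ plans N μ.variation, ∫⁻ x, cost ℓ N x ∂P : ℝ≥0∞) : EReal) else ⊤

/-- The relaxed cost: the infimum of `liminf C_N(ρ_n)` over the sequences of probabilities `ρ_n`
converging weakly* to `μ` (`+∞` if there are none). -/
def relaxedCN (ℓ : ℝ≥0 → ℝ≥0∞) (N : ℕ) (μ : Meas d) : EReal :=
  ⨅ ρs ∈ {ρs : ℕ → Meas d | (∀ n, IsProb (ρs n)) ∧ WeakStarTendsto ρs μ},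
    liminf (fun n => CN ℓ N (ρs n)) atTop

/-- `M_N` is the Legendre-Fenchel conjugate of `C_N`. -/
def MN (ℓ : ℝ≥0 → ℝ≥0∞) (N : ℕ) : C₀(Space d, ℝ) → EReal := conj (CN ℓ N)

/-- `M_∞(v) = lim M_N(v)`, written as an upper limit so that it is always defined. -/
def MInf (ℓ : ℝ≥0 → ℝ≥0∞) (v : C₀(Space d, ℝ)) : EReal := limsup (fun N => MN ℓ N v) atTop

/-- `C_∞(μ) = lim` of the relaxed costs, written as an upper limit so that it is always defined. -/
def CInf (ℓ : ℝ≥0 → ℝ≥0∞) (μ : Meas d) : EReal := limsup (fun N => relaxedCN ℓ N μ) atTop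

open Classical in
/-- The direct energy `D(ρ) = ∬ ℓ(|x - y|) dρ(x) dρ(y)`, extended by `+∞` outside the
probabilities. -/
def D (ℓ : ℝ≥0 → ℝ≥0∞) (μ : Meas d) : EReal :=
  if IsProb μ then
    ((∫⁻ p, ℓ ‖p.1 - p.2‖₊ ∂(μ.variation.prod μ.variation) : ℝ≥0∞) : EReal)
  else ⊤

open Classical in
/-- The two-homogeneous extension `D₂(ρ) = ‖ρ‖² D(ρ / ‖ρ‖)` of `D` to sub-probabilities, extended
by `+∞`. Here `‖ρ‖ = ρ(ℝᵈ)`, and `D₂(0) = 0` because `0 * ⊤ = 0` in `EReal`. -/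
def D2 (ℓ : ℝ≥0 → ℝ≥0∞) (μ : Meas d) : EReal :=
  if IsSubProb μ then
    (((μ Set.univ) ^ 2 : ℝ) : EReal) * D ℓ ((μ Set.univ)⁻¹ • μ)
  else ⊤

/-- The weak* lower semicontinuous envelope of a functional, through sequences. -/
def lscEnvelope (F : Meas d → EReal) (μ : Meas d) : EReal :=
  ⨅ μs ∈ {μs : ℕ → Meas d | WeakStarTendsto μs μ}, liminf (fun n => F (μs n)) atTop

/-- The integral of an extended real valued function: the integral of its positive part minus the
integral of its negative part. -/
def extIntegral {X : Type*} [MeasurableSpace X] (m : Measure X) (f : X → EReal) : EReal :=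
  ((∫⁻ x, (f x).toENNReal ∂m : ℝ≥0∞) : EReal) - ((∫⁻ x, (-f x).toENNReal ∂m : ℝ≥0∞) : EReal)

end MultiMarginal

end

/-!
The whole theorem comes down to the identity `M_∞ = D₂*`, through conjugation.

The cost `C_N` is convex and increases with `N` (`monotone_CN`: leave one particle out), so `M_N`
decreases, the relaxed costs increase, and both limits exist. The relaxed cost is the biconjugate of
`C_N` (`relaxedCN_eq_biconj`), because on sub-probabilities weak* lower semicontinuity is a sequential
matter: `C₀` is separable. Hence `C_∞ = sup_N M_N* = (inf_N M_N)* = M_∞*` (`CInf_eq_dualConj`), and every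
claim on `C_∞` follows from the corresponding claim on `M_∞` and from the lower semicontinuity of `D₂`
(`D2_le_liminf`).

For `M_∞`, three inequalities close a circle when `D` is finite somewhere.
* `D* ≤ M_∞` (`conj_D_le_MInf`): independent particles are a competitor for `C_N`, whence `C_N ≤ D`.
* `M_∞ ≤ D₂*` (`MInf_le_conj_D2`): `M_N(v)` is a supremum over configurations of `N` points. The
  empirical measures of nearly optimal configurations have a vague limit along a subsequence, by
  compactness of the probabilities on the one-point compactification; mass may be lost at infinity,
  so the limit is a sub-probability. The energy is lower semicontinuous along such sequences
  (`energy_le_liminf`), and it differs from the `N`-particle cost by the diagonal terms only, which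
  are `O(1 / N)` once `ℓ` has been truncated (`energy_empirical_le`).
* `D₂* ≤ D*` (`conj_D2_le_conj_D`): the mass missing from a sub-probability is restored by many small
  copies of a probability of finite energy, far away from everything and from each other
  (`exists_add_mass`). Splitting mass into `n` parts divides its self-interaction by `n`, and the
  mutual interactions vanish as `ℓ` tends to `0`.

If `D` is identically `+∞`, then `D₂` is finite at `0` only, and `D₂* = 0 ≤ M_∞` because particles can be
placed far apart (`MN_nonneg`).

For a bounded cost no truncation is needed, and the diagonal terms yield `M_N ≤ D* + ℓ(0) / N`.
-/

noncomputable section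

namespace MultiMarginal

variable {d : ℕ}

/-! ### Signed measures and the pairing -/

instance isFiniteMeasure_variation (μ : Meas d) : IsFiniteMeasure μ.variation := by
  rw [← SignedMeasure.totalVariation_eq_variation]
  unfold SignedMeasure.totalVariation
  infer_instance

theorem integrable_c0 (v : C₀(Space d, ℝ)) (m : Measure (Space d)) [IsFiniteMeasure m] :
    Integrable v m :=
  v.toBCF.integrable m

theorem pairing_toSignedMeasure (v : C₀(Space d, ℝ)) (m : Measure (Space d))
    [IsFiniteMeasure m] : pairing v m.toSignedMeasure = ∫ x, v x ∂m := by
  simp [pairing]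

theorem pairing_smul_left (c : ℝ) (v : C₀(Space d, ℝ)) (μ : Meas d) :
    pairing (c • v) μ = c • pairing v μ := by
  unfold pairing
  rw [← VectorMeasure.integral_fun_smul]
  rfl

/-- The pairing as a bilinear map, which makes the algebraic `simp` lemmas available. -/
def pairingBilin : C₀(Space d, ℝ) →ₗ[ℝ] Meas d →ₗ[ℝ] ℝ :=
  LinearMap.mk₂ ℝ pairing
    (fun u v _ => VectorMeasure.integral_fun_add (integrable_c0 u _) (integrable_c0 v _))
    (fun c v μ => pairing_smul_left c v μ)
    (fun v _ _ => VectorMeasure.integral_add_vectorMeasure (integrable_c0 v _) (integrable_c0 v _))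
    (fun c _ _ => VectorMeasure.integral_smul_vectorMeasure _ c)

theorem pairing_eq_pairingBilin (v : C₀(Space d, ℝ)) (μ : Meas d) :
    pairing v μ = pairingBilin v μ := rfl

theorem abs_pairing_le (v : C₀(Space d, ℝ)) (μ : Meas d) :
    |pairing v μ| ≤ ‖v‖ * μ.variation.real Set.univ := by
  have h := VectorMeasure.norm_integral_le_of_norm_le_const (μ := μ) (C := ‖v‖) (f := v)
    (B := (ContinuousLinearMap.lsmul ℝ ℝ : ℝ →L[ℝ] ℝ →L[ℝ] ℝ).flip)
    (.of_forall fun x => v.toBCF.norm_coe_le_norm x)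
  refine (show |pairing v μ| ≤ _ from h).trans ?_
  have hB : ‖(ContinuousLinearMap.lsmul ℝ ℝ : ℝ →L[ℝ] ℝ →L[ℝ] ℝ).flip‖ ≤ 1 := by
    rw [ContinuousLinearMap.opNorm_flip]
    exact ContinuousLinearMap.opNorm_lsmul_le
  calc _ ≤ ‖v‖ * 1 * μ.variation.real Set.univ := by gcongr
    _ = _ := by rw [mul_one]

theorem toSignedMeasure_variation {μ : Meas d} (h : 0 ≤ μ) :
    μ.variation.toSignedMeasure = μ := by
  have h' := (VectorMeasure.le_restrict_univ_iff_le _ _).2 h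
  have := SignedMeasure.toMeasureOfZeroLE_toSignedMeasure μ h'
  rw [← this]
  simp

/-- A non-negative measure pairs with a function through the ordinary integral. -/
theorem pairing_eq_integral {μ : Meas d} (h : 0 ≤ μ) (v : C₀(Space d, ℝ)) :
    pairing v μ = ∫ x, v x ∂μ.variation := by
  rw [← pairing_toSignedMeasure, toSignedMeasure_variation h]

theorem variation_univ {μ : Meas d} (h : 0 ≤ μ) :
    μ.variation Set.univ = ENNReal.ofReal (μ Set.univ) := by
  have : μ Set.univ = μ.variation.real Set.univ := by
    conv_lhs => rw [← toSignedMeasure_variation h]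
    simp
  rw [this, ofReal_measureReal]

theorem IsProb.isProbabilityMeasure {μ : Meas d} (h : IsProb μ) :
    IsProbabilityMeasure μ.variation := ⟨by simp [variation_univ h.1, h.2]⟩

theorem IsSubProb.variation_univ_le {μ : Meas d} (h : IsSubProb μ) :
    μ.variation Set.univ ≤ 1 := by
  simpa [variation_univ h.1] using h.2

theorem isProb_toSignedMeasure (m : Measure (Space d)) [IsProbabilityMeasure m] :
    IsProb m.toSignedMeasure := ⟨m.zero_le_toSignedMeasure, by simp⟩

theorem isSubProb_toSignedMeasure (m : Measure (Space d)) [IsFiniteMeasure m]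
    (h : m Set.univ ≤ 1) : IsSubProb m.toSignedMeasure :=
  ⟨m.zero_le_toSignedMeasure, by
    simpa [measureReal_def] using ENNReal.toReal_mono ENNReal.one_ne_top h⟩

theorem IsProb.isSubProb {μ : Meas d} (h : IsProb μ) : IsSubProb μ := ⟨h.1, h.2.le⟩

/-- A finite signed measure is determined by its pairings with `C₀`. -/
theorem ext_of_pairing {μ ν : Meas d} (h : ∀ v, pairing v μ = pairing v ν) : μ = ν := by
  rw [← sub_eq_zero]
  set κ := μ - ν
  have hκ : ∀ v, pairing v κ = 0 := fun v => by
    rw [pairing_eq_pairingBilin, map_sub, sub_eq_zero]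
    exact h v
  have hJ := SignedMeasure.toSignedMeasure_toJordanDecomposition κ
  set j := κ.toJordanDecomposition
  have hj : κ = j.posPart.toSignedMeasure - j.negPart.toSignedMeasure := hJ.symm
  have : j.posPart = j.negPart := by
    refine Measure.ext_of_integral_eq_on_compactlySupported fun f => ?_
    let v : C₀(Space d, ℝ) := ⟨f.toContinuousMap, f.hasCompactSupport.is_zero_at_infty⟩
    have := hκ v
    rw [hj, pairing_eq_pairingBilin, map_sub, ← pairing_eq_pairingBilin,
      ← pairing_eq_pairingBilin, pairing_toSignedMeasure, pairing_toSignedMeasure, sub_eq_zero] at this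
    exact this
  rw [hj, Measure.toSignedMeasure_congr this, sub_self]

/-! ### The one-point compactification -/

instance : MeasurableSpace (OnePoint (Space d)) := borel _

instance : BorelSpace (OnePoint (Space d)) := ⟨rfl⟩

instance : TopologicalSpace.MetrizableSpace (OnePoint (Space d)) :=
  (onePointEquivSphereOfFinrankEq (ι := Fin (d + 1)) (V := Space d) (by simp)).isEmbedding.metrizableSpace

instance : SecondCountableTopology (OnePoint (Space d)) :=
  (onePointEquivSphereOfFinrankEq (ι := Fin (d + 1)) (V := Space d) (by simp)).secondCountableTopology

/-- The extension of a function of `C₀` by `0` at infinity. -/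
def extendC0 (v : C₀(Space d, ℝ)) : C(OnePoint (Space d), ℝ) :=
  OnePoint.continuousMapMk v.toContinuousMap 0 (by
    rw [Filter.coclosedCompact_eq_cocompact]; exact v.zero_at_infty')

/-- `C₀` is separable, since extension by `0` embeds it isometrically into the continuous functions
on a compact metrizable space. -/
theorem exists_dense_seq_c0 (d : ℕ) : ∃ w : ℕ → C₀(Space d, ℝ), DenseRange w := by
  have hiso : Isometry (extendC0 (d := d)) := by
    refine Isometry.of_dist_eq fun u v => le_antisymm ?_ ?_
    · refine (ContinuousMap.dist_le dist_nonneg).2 fun x => ?_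
      induction x using OnePoint.rec with
      | infty => exact (dist_self (0 : ℝ)).trans_le dist_nonneg
      | coe x => exact u.toBCF.dist_coe_le_dist (g := v.toBCF) x
    · refine (BoundedContinuousFunction.dist_le dist_nonneg).2 fun x => ?_
      exact ContinuousMap.dist_apply_le_dist (f := extendC0 u) (g := extendC0 v) (x : OnePoint _)
  have : TopologicalSpace.SeparableSpace C₀(Space d, ℝ) := by
    have := hiso.isEmbedding.isInducing.secondCountableTopology
    infer_instance
  exact TopologicalSpace.exists_dense_seq _

/-! ### Vague convergence of sub-probabilities -/

/-- Convergence of measures tested against `C₀`. -/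
def VagueTendsto (ms : ℕ → Measure (Space d)) (m : Measure (Space d)) : Prop :=
  ∀ v : C₀(Space d, ℝ), Tendsto (fun n => ∫ x, v x ∂(ms n)) atTop (𝓝 (∫ x, v x ∂m))

/-- The probability on the one-point compactification obtained from a sub-probability by placing
the missing mass at infinity. -/
def compactify (m : Measure (Space d)) : Measure (OnePoint (Space d)) :=
  m.map (↑) + (1 - m Set.univ) • Measure.dirac OnePoint.infty

theorem measurableEmbedding_coe : MeasurableEmbedding ((↑) : Space d → OnePoint (Space d)) :=
  OnePoint.isOpenEmbedding_coe.measurableEmbedding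

theorem isProbabilityMeasure_compactify {m : Measure (Space d)} (h : m Set.univ ≤ 1) :
    IsProbabilityMeasure (compactify m) := by
  constructor
  rw [compactify, Measure.add_apply, Measure.map_apply measurableEmbedding_coe.measurable .univ]
  simp [add_tsub_cancel_of_le h]

/-- `compactify` as a map between bundled measures. -/
def compactifyProb (m : Measure (Space d)) (h : m Set.univ ≤ 1) :
    ProbabilityMeasure (OnePoint (Space d)) :=
  ⟨compactify m, isProbabilityMeasure_compactify h⟩

/-- Subtracting the value at infinity absorbs the atom of `compactify m`. -/
theorem integral_compactify {m : Measure (Space d)} (h : m Set.univ ≤ 1)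
    (f : C(OnePoint (Space d), ℝ)) :
    ∫ x, f x ∂(compactify m) = ∫ x : Space d, (f x - f OnePoint.infty) ∂m + f OnePoint.infty := by
  have hfin : IsFiniteMeasure m := ⟨h.trans_lt ENNReal.one_lt_top⟩
  have hfin' : IsFiniteMeasure ((1 - m Set.univ) • Measure.dirac (OnePoint.infty : OnePoint (Space d))) :=
    ⟨by simpa using lt_of_le_of_lt tsub_le_self ENNReal.one_lt_top⟩
  have hint : ∀ M : Measure (OnePoint (Space d)), [IsFiniteMeasure M] → Integrable f M :=
    fun M _ => (BoundedContinuousFunction.mkOfCompact f).integrable M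
  have hint' : Integrable (fun x : Space d => f x) m :=
    measurableEmbedding_coe.integrable_map_iff.1 (hint (m.map (↑)))
  rw [compactify, integral_add_measure (hint _) (hint _), measurableEmbedding_coe.integral_map,
    integral_sub hint' (integrable_const _), integral_smul_measure, integral_dirac,
    ENNReal.toReal_sub_of_le h ENNReal.one_ne_top]
  simp [measureReal_def]
  ring

theorem tendsto_compactify {ms : ℕ → Measure (Space d)} {m : Measure (Space d)}
    (hs : ∀ n, ms n Set.univ ≤ 1) (h : m Set.univ ≤ 1) (hlim : VagueTendsto ms m) :
    Tendsto (fun n => compactifyProb (ms n) (hs n)) atTop (𝓝 (compactifyProb m h)) := by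
  refine ProbabilityMeasure.tendsto_iff_forall_integral_tendsto.2 fun f => ?_
  let v : C₀(Space d, ℝ) :=
    ⟨⟨fun x => f x - f OnePoint.infty,
      (f.continuous.comp OnePoint.continuous_coe).sub continuous_const⟩, by
      have h1 : Tendsto (fun x : Space d => f x) (cocompact _) (𝓝 (f OnePoint.infty)) :=
        (f.continuous.tendsto _).comp (by
          rw [← Filter.coclosedCompact_eq_cocompact]
          exact OnePoint.tendsto_coe_infty)
      simpa using h1.sub_const (f OnePoint.infty)⟩
  have key : ∀ {m : Measure (Space d)} (h : m Set.univ ≤ 1),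
      ∫ x, f x ∂(compactifyProb m h : Measure (OnePoint (Space d)))
        = ∫ x, v x ∂m + f OnePoint.infty := fun h => integral_compactify h f.toContinuousMap
  simp only [key]
  exact (hlim v).add_const _

theorem restrict_compactify (m : Measure (Space d)) :
    (compactify m).restrict (Set.range OnePoint.some) = m.map ((↑) : Space d → OnePoint (Space d)) := by
  have h1 : MeasurableSet (Set.range ((↑) : Space d → OnePoint (Space d))) :=
    measurableEmbedding_coe.measurableSet_range
  have h2 : (OnePoint.infty : OnePoint (Space d)) ∉ Set.range OnePoint.some := by simp
  classical
  rw [compactify, Measure.restrict_add, Measure.restrict_smul, restrict_dirac' h1, if_neg h2,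
    smul_zero, add_zero, Measure.restrict_eq_self_of_ae_mem]
  rw [measurableEmbedding_coe.ae_map_iff]
  simp

/-- Sub-probabilities are vaguely sequentially compact. -/
theorem exists_subseq_vagueTendsto {ms : ℕ → Measure (Space d)} (hs : ∀ n, ms n Set.univ ≤ 1) :
    ∃ m : Measure (Space d), m Set.univ ≤ 1 ∧ ∃ φ : ℕ → ℕ, StrictMono φ ∧
      VagueTendsto (fun n => ms (φ n)) m := by
  obtain ⟨ν, φ, hφ, hν⟩ := CompactSpace.tendsto_subseq (fun n => compactifyProb (ms n) (hs n))
  have hmle : ((ν : Measure (OnePoint (Space d))).comap (↑)) (Set.univ : Set (Space d)) ≤ 1 := by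
    rw [measurableEmbedding_coe.comap_apply]
    exact prob_le_one
  refine ⟨_, hmle, φ, hφ, fun v => ?_⟩
  have h1 := ProbabilityMeasure.tendsto_iff_forall_integral_tendsto.1 hν
    (BoundedContinuousFunction.mkOfCompact (extendC0 v))
  have h0 : extendC0 v OnePoint.infty = 0 := rfl
  have hc : ∀ x : Space d, extendC0 v x = v x := fun _ => rfl
  have key : ∀ n, ∫ x, extendC0 v x ∂(compactify (ms n)) = ∫ x, v x ∂(ms n) := fun n => by
    rw [integral_compactify (hs n)]
    simp [h0, hc]
  have hlim : ∫ x, extendC0 v x ∂(ν : Measure (OnePoint (Space d)))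
      = ∫ x : Space d, v x ∂((ν : Measure (OnePoint (Space d))).comap (↑)) := by
    calc _ = ∫ x in Set.range ((↑) : Space d → _), extendC0 v x ∂(ν : Measure (OnePoint (Space d))) := by
          refine (setIntegral_eq_integral_of_forall_compl_eq_zero fun x hx => ?_).symm
          induction x using OnePoint.rec with
          | infty => exact h0
          | coe x => exact absurd ⟨x, rfl⟩ hx
      _ = _ := by
          rw [← measurableEmbedding_coe.map_comap, measurableEmbedding_coe.integral_map]
          rfl
  rw [← hlim]
  simp only [← key]
  exact h1

theorem prod_compactify_image {m : Measure (Space d)} (h : m Set.univ ≤ 1)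
    {G : Set (Space d × Space d)} (hG : IsOpen G) :
    (compactify m).prod (compactify m) (Prod.map (↑) (↑) '' G) = m.prod m G := by
  have := isProbabilityMeasure_compactify h
  have hfin : IsFiniteMeasure m := ⟨h.trans_lt ENNReal.one_lt_top⟩
  have hemb : Topology.IsOpenEmbedding
      (Prod.map (↑) (↑) : Space d × Space d → OnePoint (Space d) × OnePoint (Space d)) :=
    OnePoint.isOpenEmbedding_coe.prodMap OnePoint.isOpenEmbedding_coe
  have hGo : MeasurableSet (Prod.map (↑) (↑) '' G : Set (OnePoint (Space d) × OnePoint (Space d))) :=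
    (hemb.isOpenMap _ hG).measurableSet
  calc _ = (((compactify m).prod (compactify m)).restrict
          (Set.range OnePoint.some ×ˢ Set.range OnePoint.some)) (Prod.map (↑) (↑) '' G) := by
        rw [Measure.restrict_apply hGo, Set.inter_eq_left.2]
        rintro _ ⟨p, -, rfl⟩
        exact ⟨⟨_, rfl⟩, ⟨_, rfl⟩⟩
    _ = _ := by
        rw [← Measure.prod_restrict, restrict_compactify,
          Measure.map_prod_map _ _ measurableEmbedding_coe.measurable
            measurableEmbedding_coe.measurable, Measure.map_apply hemb.continuous.measurable hGo,
          Set.preimage_image_eq _ hemb.injective]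

/-- The open set inequality of the portmanteau theorem for products. Mass may escape, so the weak
convergence used is that of the products of the compactified measures; an open set of pairs of
finite points remains open in the product of the compactifications. -/
theorem prod_open_le_liminf {ms : ℕ → Measure (Space d)} {m : Measure (Space d)}
    (hs : ∀ n, ms n Set.univ ≤ 1) (h : m Set.univ ≤ 1) (hlim : VagueTendsto ms m)
    {G : Set (Space d × Space d)} (hG : IsOpen G) :
    m.prod m G ≤ liminf (fun n => (ms n).prod (ms n) G) atTop := by
  have hemb : Topology.IsOpenEmbedding
      (Prod.map (↑) (↑) : Space d × Space d → OnePoint (Space d) × OnePoint (Space d)) :=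
    OnePoint.isOpenEmbedding_coe.prodMap OnePoint.isOpenEmbedding_coe
  have h1 := tendsto_compactify hs h hlim
  have h2 := (ProbabilityMeasure.continuous_prod.tendsto
    (compactifyProb m h, compactifyProb m h)).comp (h1.prodMk_nhds h1)
  have h3 := ProbabilityMeasure.le_liminf_measure_open_of_tendsto h2 (hemb.isOpenMap _ hG)
  have key : ∀ {m : Measure (Space d)} (h : m Set.univ ≤ 1),
    (((compactifyProb m h).prod (compactifyProb m h) : ProbabilityMeasure _) :
      Measure (OnePoint (Space d) × OnePoint (Space d))) (Prod.map (↑) (↑) '' G) = m.prod m G :=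
    fun h => prod_compactify_image h hG
  simpa only [Function.comp_def, key] using h3

/-- The lower semicontinuous form of the portmanteau theorem. -/
theorem lintegral_le_liminf_of_lowerSemicontinuous {Ω : Type*} [TopologicalSpace Ω]
    [MeasurableSpace Ω] [OpensMeasurableSpace Ω] {μ : Measure Ω} {μs : ℕ → Measure Ω}
    {f : Ω → ℝ≥0∞} (hf : LowerSemicontinuous f)
    (hopen : ∀ G, IsOpen G → μ G ≤ liminf (fun n => μs n G) atTop) :
    ∫⁻ x, f x ∂μ ≤ liminf (fun n => ∫⁻ x, f x ∂(μs n)) atTop := by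
  have key : ∀ k : ℕ, ∫⁻ x, min (f x) k ∂μ ≤ liminf (fun n => ∫⁻ x, f x ∂(μs n)) atTop := fun k => by
    let g : Ω → ℝ := fun x => (min (f x) k).toReal
    have hfin : ∀ x, min (f x) k ≠ ⊤ := fun x => by simp
    have hg : ∀ x, ENNReal.ofReal (g x) = min (f x) k := fun x => ENNReal.ofReal_toReal (hfin x)
    have hgo : ∀ t ∈ Set.Ioi (0 : ℝ), IsOpen {x | t < g x} := fun t ht => by
      have : {x | t < g x} = {x | ENNReal.ofReal t < f x} ∩ {x | ENNReal.ofReal t < k} := by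
        ext x
        simp only [Set.mem_ofPred_eq, g, Set.mem_inter_iff]
        rw [← ENNReal.ofReal_lt_iff_lt_toReal (le_of_lt ht) (hfin x), lt_min_iff]
      rw [this]
      exact (hf.isOpen_preimage _).inter isOpen_const
    have hgm : Measurable g := (hf.measurable.min measurable_const).ennreal_toReal
    simp_rw [← hg]
    calc ∫⁻ x, ENNReal.ofReal (g x) ∂μ
        = ∫⁻ t in Set.Ioi (0 : ℝ), μ {x | t < g x} :=
          lintegral_eq_lintegral_meas_lt _ (.of_forall fun _ => ENNReal.toReal_nonneg) hgm.aemeasurable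
      _ ≤ ∫⁻ t in Set.Ioi (0 : ℝ), liminf (fun n => μs n {x | t < g x}) atTop :=
          setLIntegral_mono' measurableSet_Ioi fun t ht => hopen _ (hgo t ht)
      _ ≤ liminf (fun n => ∫⁻ t in Set.Ioi (0 : ℝ), μs n {x | t < g x}) atTop :=
          lintegral_liminf_le fun n => Antitone.measurable fun s t hst =>
            measure_mono fun x hx => lt_of_le_of_lt hst hx
      _ = liminf (fun n => ∫⁻ x, ENNReal.ofReal (g x) ∂(μs n)) atTop := by
          congr 1; ext n
          exact (lintegral_eq_lintegral_meas_lt _ (.of_forall fun _ => ENNReal.toReal_nonneg)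
            hgm.aemeasurable).symm
      _ ≤ _ := by
          refine liminf_le_liminf (.of_forall fun n => lintegral_mono fun x => ?_)
          rw [hg]; exact min_le_left _ _
  have hsup : ∀ x, f x = ⨆ k : ℕ, min (f x) k := fun x => by
    rw [← inf_iSup_eq, ENNReal.iSup_natCast, inf_top_eq]
  calc ∫⁻ x, f x ∂μ = ∫⁻ x, ⨆ k : ℕ, min (f x) k ∂μ := lintegral_congr hsup
    _ = ⨆ k : ℕ, ∫⁻ x, min (f x) k ∂μ :=
        lintegral_iSup (fun k => hf.measurable.min measurable_const)
          fun i j hij x => min_le_min_left _ (by exact_mod_cast hij)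
    _ ≤ _ := iSup_le key

/-! ### The interaction energy -/

/-- The interaction energy `∬ ℓ(|x - y|) dm(x) dm(y)`. -/
def energy (ℓ : ℝ≥0 → ℝ≥0∞) (m : Measure (Space d)) : ℝ≥0∞ :=
  ∫⁻ p, ℓ ‖p.1 - p.2‖₊ ∂(m.prod m)

theorem lowerSemicontinuous_interaction {ℓ : ℝ≥0 → ℝ≥0∞} (hℓ : LowerSemicontinuous ℓ) :
    LowerSemicontinuous fun p : Space d × Space d => ℓ ‖p.1 - p.2‖₊ :=
  hℓ.comp (by fun_prop)

/-- The interaction energy is lower semicontinuous under vague convergence, loss of mass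
included. -/
theorem energy_le_liminf {ℓ : ℝ≥0 → ℝ≥0∞} (hℓ : LowerSemicontinuous ℓ)
    {ms : ℕ → Measure (Space d)} {m : Measure (Space d)}
    (hs : ∀ n, ms n Set.univ ≤ 1) (h : m Set.univ ≤ 1) (hlim : VagueTendsto ms m) :
    energy ℓ m ≤ liminf (fun n => energy ℓ (ms n)) atTop :=
  lintegral_le_liminf_of_lowerSemicontinuous (lowerSemicontinuous_interaction hℓ)
    fun _ hG => prod_open_le_liminf hs h hlim hG

/-- The weak* limit of a sequence of sub-probabilities is a sub-probability. -/
theorem isSubProb_of_weakStarTendsto {μs : ℕ → Meas d} {μ : Meas d} (hs : ∀ n, IsSubProb (μs n))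
    (hlim : WeakStarTendsto μs μ) : IsSubProb μ := by
  obtain ⟨m, hm, φ, hφ, h⟩ := exists_subseq_vagueTendsto fun n => (hs n).variation_univ_le
  have hfin : IsFiniteMeasure m := ⟨hm.trans_lt ENNReal.one_lt_top⟩
  have : μ = m.toSignedMeasure := ext_of_pairing fun v => by
    rw [pairing_toSignedMeasure]
    refine tendsto_nhds_unique ((hlim v).comp hφ.tendsto_atTop) ?_
    simpa only [Function.comp_def, pairing_eq_integral (hs _).1] using h v
  rw [this]
  exact isSubProb_toSignedMeasure m hm

theorem vagueTendsto_variation {μs : ℕ → Meas d} {μ : Meas d} (hs : ∀ n, 0 ≤ μs n) (h : 0 ≤ μ)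
    (hlim : WeakStarTendsto μs μ) : VagueTendsto (fun n => (μs n).variation) μ.variation :=
  fun v => by simpa only [pairing_eq_integral (hs _), pairing_eq_integral h] using hlim v

/-! ### The `N`-particle cost -/

/-- The cost as a normalised sum over ordered pairs. -/
theorem cost_eq_sum_erase (ℓ : ℝ≥0 → ℝ≥0∞) (N : ℕ) (x : Fin N → Space d) :
    cost ℓ N x = ((N * (N - 1) : ℕ) : ℝ≥0∞)⁻¹ *
      ∑ i : Fin N, ∑ j ∈ Finset.univ.erase i, ℓ ‖x i - x j‖₊ := by
  have h1 : ∀ i : Fin N, Finset.univ.erase i = Finset.Ioi i ∪ Finset.Iio i := fun i => by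
    ext j
    simp only [Finset.mem_erase, Finset.mem_univ, and_true, Finset.mem_union, Finset.mem_Ioi,
      Finset.mem_Iio]
    exact ne_iff_lt_or_gt.trans or_comm
  have h2 : ∀ i : Fin N, Disjoint (Finset.Ioi i) (Finset.Iio i) := fun i =>
    Finset.disjoint_left.2 fun j hj hj' => by
      simp only [Finset.mem_Ioi, Finset.mem_Iio] at hj hj'
      exact lt_asymm hj hj'
  have h3 : ∑ i : Fin N, ∑ j ∈ Finset.Iio i, ℓ ‖x i - x j‖₊
      = ∑ i : Fin N, ∑ j ∈ Finset.Ioi i, ℓ ‖x i - x j‖₊ := by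
    rw [Finset.sum_comm' (t' := Finset.univ) (s' := fun j => Finset.Ioi j) (by simp)]
    refine Finset.sum_congr rfl fun i _ => Finset.sum_congr rfl fun j _ => ?_
    rw [← nnnorm_neg, neg_sub]
  simp_rw [h1, fun i => Finset.sum_union (h2 i) (f := fun j => ℓ ‖x i - x j‖₊),
    Finset.sum_add_distrib, h3]
  rw [cost, ← two_mul, div_eq_mul_inv, mul_comm (2 : ℝ≥0∞), mul_assoc]

theorem measurable_cost {ℓ : ℝ≥0 → ℝ≥0∞} (hℓ : Measurable ℓ) (N : ℕ) :
    Measurable (cost (d := d) ℓ N) := by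
  unfold cost
  fun_prop

theorem sum_succAbove {M : Type*} [AddCommMonoid M] {N : ℕ} (i : Fin (N + 1))
    (f : Fin (N + 1) → M) : ∑ a, f (i.succAbove a) = ∑ p, if p = i then 0 else f p := by
  rw [Fin.sum_univ_succAbove _ i]
  simp

/-- Every ordered pair of distinct indices survives the removal of `N - 1` of the `N + 1`
indices. -/
theorem sum_succAbove_pairs {N : ℕ} (F : Fin (N + 1) → Fin (N + 1) → ℝ≥0∞) :
    ∑ i : Fin (N + 1), ∑ a : Fin N, ∑ b ∈ Finset.univ.erase a,
      F (i.succAbove a) (i.succAbove b)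
      = ((N - 1 : ℕ) : ℝ≥0∞) * ∑ p, ∑ q ∈ Finset.univ.erase p, F p q := by
  have h0 : ∀ {n : ℕ} (a : Fin n) (f : Fin n → ℝ≥0∞),
      ∑ b ∈ Finset.univ.erase a, f b = ∑ b, if b = a then 0 else f b := fun a f => by
    rw [← Finset.filter_ne', Finset.sum_filter]
    exact Finset.sum_congr rfl fun b _ => by by_cases h : b = a <;> simp [h]
  simp_rw [h0]
  have h1 : ∀ i : Fin (N + 1), ∑ a : Fin N, ∑ b : Fin N,
      (if b = a then 0 else F (i.succAbove a) (i.succAbove b))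
      = ∑ p, ∑ q, if p = i ∨ q = i ∨ q = p then 0 else F p q := fun i => by
    have e1 : ∀ p, (∑ q, if p = i ∨ q = i ∨ q = p then 0 else F p q)
        = if p = i then 0 else ∑ q, if q = i then 0 else if q = p then 0 else F p q := fun p => by
      by_cases hp : p = i
      · simp [hp]
      · simp [hp, ite_or]
    simp_rw [e1]
    rw [← sum_succAbove i fun p => ∑ q, if q = i then 0 else if q = p then 0 else F p q]
    refine Finset.sum_congr rfl fun a _ => ?_
    rw [← sum_succAbove i fun q => if q = i.succAbove a then 0 else F (i.succAbove a) q]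
    simp
  simp_rw [h1, Finset.mul_sum]
  rw [Finset.sum_comm]
  refine Finset.sum_congr rfl fun p _ => ?_
  rw [Finset.sum_comm]
  refine Finset.sum_congr rfl fun q _ => ?_
  by_cases hqp : q = p
  · simp [hqp]
  · have hf : ∀ i, (if p = i ∨ q = i ∨ q = p then (0 : ℝ≥0∞) else F p q)
        = if i ∈ ({p, q} : Finset (Fin (N + 1)))ᶜ then F p q else 0 := fun i => by
      have : i ∈ ({p, q} : Finset (Fin (N + 1)))ᶜ ↔ ¬ (p = i ∨ q = i ∨ q = p) := by
        simp [hqp, eq_comm]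
      simp only [this, ite_not]
    simp_rw [hf]
    rw [Finset.sum_ite_mem, Finset.univ_inter, Finset.sum_const, Finset.card_compl,
      Finset.card_pair (Ne.symm hqp), nsmul_eq_mul, if_neg hqp, Fintype.card_fin]
    rfl

/-- The `(N + 1)`-particle cost dominates the mean of the `N`-particle costs obtained by leaving
one particle out. They are equal for `N ≥ 2`; the cases `N ≤ 1` are trivial, the left-hand side
being `0`. -/
theorem sum_cost_succAbove_le (ℓ : ℝ≥0 → ℝ≥0∞) (N : ℕ) (x : Fin (N + 1) → Space d) :
    ∑ i : Fin (N + 1), cost ℓ N (fun a => x (i.succAbove a))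
      ≤ ((N + 1 : ℕ) : ℝ≥0∞) * cost ℓ (N + 1) x := by
  simp_rw [cost_eq_sum_erase, ← Finset.mul_sum]
  rw [sum_succAbove_pairs fun p q => ℓ ‖x p - x q‖₊, ← mul_assoc, ← mul_assoc]
  rcases Nat.lt_or_ge N 2 with h | h
  · interval_cases N <;> simp
  · have e1 : ((N * (N - 1) : ℕ) : ℝ≥0∞)⁻¹ * ((N - 1 : ℕ) : ℝ≥0∞) = (N : ℝ≥0∞)⁻¹ := by
      have : ((N - 1 : ℕ) : ℝ≥0∞) ≠ 0 := by
        exact_mod_cast (by omega : N - 1 ≠ 0)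
      rw [Nat.cast_mul, ENNReal.mul_inv (by simp) (by simp), mul_assoc,
        ENNReal.inv_mul_cancel this (by simp), mul_one]
    have e2 : ((N + 1 : ℕ) : ℝ≥0∞) * (((N + 1) * (N + 1 - 1) : ℕ) : ℝ≥0∞)⁻¹ = (N : ℝ≥0∞)⁻¹ := by
      rw [Nat.cast_mul, ENNReal.mul_inv (by simp) (by simp), ← mul_assoc,
        ENNReal.mul_inv_cancel (by simp) (by simp), one_mul, Nat.add_sub_cancel]
    rw [e1, e2]

/-! ### The multi-marginal cost `C_N` -/

/-- The multi-marginal cost on `Measure`s. -/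
def otCost (ℓ : ℝ≥0 → ℝ≥0∞) (N : ℕ) (m : Measure (Space d)) : ℝ≥0∞ :=
  ⨅ P ∈ plans N m, ∫⁻ x, cost ℓ N x ∂P

theorem CN_of_isProb {ℓ : ℝ≥0 → ℝ≥0∞} {N : ℕ} {μ : Meas d} (h : IsProb μ) :
    CN ℓ N μ = (otCost ℓ N μ.variation : EReal) := if_pos h

theorem CN_of_not_isProb {ℓ : ℝ≥0 → ℝ≥0∞} {N : ℕ} {μ : Meas d} (h : ¬ IsProb μ) :
    CN ℓ N μ = ⊤ := if_neg h

theorem D_of_isProb {ℓ : ℝ≥0 → ℝ≥0∞} {μ : Meas d} (h : IsProb μ) :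
    D ℓ μ = (energy ℓ μ.variation : EReal) := if_pos h

theorem D_of_not_isProb {ℓ : ℝ≥0 → ℝ≥0∞} {μ : Meas d} (h : ¬ IsProb μ) :
    D ℓ μ = ⊤ := if_neg h

/-- The marginals on `N` of the `N + 1` particles of a plan are plans; one of them costs no more than
their mean. -/
theorem otCost_le_succ {ℓ : ℝ≥0 → ℝ≥0∞} (hℓ : Measurable ℓ) (N : ℕ) (m : Measure (Space d)) :
    otCost ℓ N m ≤ otCost ℓ (N + 1) m := by
  refine le_iInf₂ fun P hP => ?_
  have := hP.1
  have hmeas : ∀ i : Fin (N + 1),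
      Measurable fun (x : Fin (N + 1) → Space d) (a : Fin N) => x (i.succAbove a) := fun i => by
    fun_prop
  have h1 : ∀ i : Fin (N + 1),
      otCost ℓ N m ≤ ∫⁻ x, cost ℓ N (fun a => x (i.succAbove a)) ∂P := fun i => by
    rw [← lintegral_map (measurable_cost hℓ N) (hmeas i)]
    refine iInf₂_le _ ⟨Measure.isProbabilityMeasure_map (hmeas i).aemeasurable, fun j => ?_⟩
    rw [Measure.map_map (by fun_prop) (hmeas i)]
    exact hP.2 _
  have h2 : ((N + 1 : ℕ) : ℝ≥0∞) * otCost ℓ N m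
      ≤ ((N + 1 : ℕ) : ℝ≥0∞) * ∫⁻ x, cost ℓ (N + 1) x ∂P := by
    calc _ = ∑ i : Fin (N + 1), otCost ℓ N m := by simp
      _ ≤ ∑ i : Fin (N + 1), ∫⁻ x, cost ℓ N (fun a => x (i.succAbove a)) ∂P :=
          Finset.sum_le_sum fun i _ => h1 i
      _ = ∫⁻ x, ∑ i : Fin (N + 1), cost ℓ N (fun a => x (i.succAbove a)) ∂P :=
          (lintegral_finsetSum _ fun i _ => (measurable_cost hℓ N).comp (hmeas i)).symm
      _ ≤ ∫⁻ x, ((N + 1 : ℕ) : ℝ≥0∞) * cost ℓ (N + 1) x ∂P :=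
          lintegral_mono fun x => sum_cost_succAbove_le ℓ N x
      _ = _ := lintegral_const_mul _ (measurable_cost hℓ _)
  exact (ENNReal.mul_le_mul_iff_right (by simp) (by simp)).1 h2

theorem monotone_CN {ℓ : ℝ≥0 → ℝ≥0∞} (hℓ : Measurable ℓ) (μ : Meas d) :
    Monotone fun N => CN ℓ N μ := by
  refine monotone_nat_of_le_succ fun N => ?_
  by_cases h : IsProb μ
  · simp only [CN_of_isProb h]
    exact_mod_cast otCost_le_succ hℓ N _
  · simp [CN_of_not_isProb h]

/-- Independent particles are a competitor for `C_N`. -/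
theorem otCost_le_energy {ℓ : ℝ≥0 → ℝ≥0∞} (hℓ : Measurable ℓ) (N : ℕ) (m : Measure (Space d))
    [IsProbabilityMeasure m] : otCost ℓ N m ≤ energy ℓ m := by
  have hpair : ∀ i j : Fin N, i ≠ j →
      ∫⁻ x, ℓ ‖x i - x j‖₊ ∂(Measure.pi fun _ : Fin N => m) = energy ℓ m := fun i j hij => by
    have hind : ProbabilityTheory.iIndepFun (fun (k : Fin N) (x : Fin N → Space d) => x k)
        (Measure.pi fun _ : Fin N => m) :=
      ProbabilityTheory.iIndepFun_pi (X := fun _ => id) fun _ => aemeasurable_id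
    have := (ProbabilityTheory.indepFun_iff_map_prod_eq_prod_map_map
      (measurable_pi_apply i).aemeasurable (measurable_pi_apply j).aemeasurable).1
      (hind.indepFun hij)
    rw [(measurePreserving_eval (fun _ : Fin N => m) i).map_eq, (measurePreserving_eval (fun _ : Fin N => m) j).map_eq] at this
    rw [energy, ← this, lintegral_map (by fun_prop) (by fun_prop)]
  refine (iInf₂_le (Measure.pi fun _ : Fin N => m)
    ⟨inferInstance, fun j => (measurePreserving_eval (fun _ : Fin N => m) j).map_eq⟩).trans ?_
  simp_rw [cost_eq_sum_erase]
  rw [lintegral_const_mul _ (by fun_prop), lintegral_finsetSum _ (by fun_prop)]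
  have : ∀ i : Fin N, ∫⁻ x, ∑ j ∈ Finset.univ.erase i, ℓ ‖x i - x j‖₊ ∂(Measure.pi fun _ : Fin N => m)
      = ((N - 1 : ℕ) : ℝ≥0∞) * energy ℓ m := fun i => by
    rw [lintegral_finsetSum _ (by fun_prop), Finset.sum_congr rfl fun j hj =>
      hpair i j (Finset.ne_of_mem_erase hj).symm]
    simp
  simp_rw [this]
  rw [Finset.sum_const, Finset.card_univ, Fintype.card_fin, nsmul_eq_mul, ← mul_assoc, ← mul_assoc,
    mul_assoc _ (N : ℝ≥0∞), ← Nat.cast_mul]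
  exact mul_le_of_le_one_left (by simp) (ENNReal.inv_mul_le_one _)

theorem CN_le_D {ℓ : ℝ≥0 → ℝ≥0∞} (hℓ : Measurable ℓ) (N : ℕ) (μ : Meas d) :
    CN ℓ N μ ≤ D ℓ μ := by
  by_cases h : IsProb μ
  · have := h.isProbabilityMeasure
    rw [CN_of_isProb h, D_of_isProb h]
    exact_mod_cast otCost_le_energy hℓ N _
  · simp [D_of_not_isProb h]

/-! ### Differences of a real number and an extended non-negative one -/

theorem coe_lt_coe_sub_iff {a p : ℝ} {c : ℝ≥0∞} :
    (a : EReal) < (p : EReal) - (c : EReal) ↔ c < ENNReal.ofReal (p - a) := by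
  induction c with
  | top => simp
  | coe c =>
    have : ((c : ℝ≥0∞) : EReal) = ((c : ℝ) : EReal) := rfl
    rw [this, ← EReal.coe_sub, EReal.coe_lt_coe_iff, ← ENNReal.ofReal_coe_nnreal,
      ENNReal.ofReal_lt_ofReal_iff_of_nonneg (NNReal.coe_nonneg c)]
    exact lt_sub_comm

theorem coe_le_coe_sub_of_le {a p : ℝ} {c : ℝ≥0∞} (hap : a ≤ p)
    (h : c ≤ ENNReal.ofReal (p - a)) : (a : EReal) ≤ (p : EReal) - (c : EReal) := by
  lift c to ℝ≥0 using ne_top_of_le_ne_top ENNReal.ofReal_ne_top h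
  have : ((c : ℝ≥0∞) : EReal) = ((c : ℝ) : EReal) := rfl
  rw [this, ← EReal.coe_sub, EReal.coe_le_coe_iff]
  rw [← ENNReal.ofReal_coe_nnreal, ENNReal.ofReal_le_ofReal_iff (sub_nonneg.2 hap)] at h
  linarith

/-! ### The energies of signed measures -/

theorem integral_sub_energy_le_conj_D (ℓ : ℝ≥0 → ℝ≥0∞) (v : C₀(Space d, ℝ))
    (m : Measure (Space d)) [IsProbabilityMeasure m] :
    ((∫ x, v x ∂m : ℝ) : EReal) - (energy ℓ m : EReal) ≤ conj (D ℓ) v := by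
  refine le_trans (le_of_eq ?_) (le_iSup _ m.toSignedMeasure)
  rw [D_of_isProb (isProb_toSignedMeasure m), pairing_toSignedMeasure,
    Measure.variation_toSignedMeasure]

theorem energy_smul (ℓ : ℝ≥0 → ℝ≥0∞) (c : ℝ≥0) (m : Measure (Space d)) [SFinite m] :
    energy ℓ (c • m) = (c : ℝ≥0∞) ^ 2 * energy ℓ m := by
  rw [energy, energy, Measure.prod_smul_left, Measure.prod_smul_right, smul_smul,
    lintegral_smul_measure, ENNReal.smul_def, smul_eq_mul, ENNReal.coe_mul, pow_two]

/-- The two-homogeneous extension is the energy, without normalisation. -/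
theorem D2_of_isSubProb {ℓ : ℝ≥0 → ℝ≥0∞} {μ : Meas d} (h : IsSubProb μ) :
    D2 ℓ μ = (energy ℓ μ.variation : EReal) := by
  rw [D2, if_pos h]
  have h0 : 0 ≤ μ Set.univ := VectorMeasure.le_iff.1 h.1 _ .univ
  rcases h0.eq_or_lt with h0 | h0
  · have : μ.variation = 0 := by
      rw [← Measure.measure_univ_eq_zero, variation_univ h.1, ← h0, ENNReal.ofReal_zero]
    simp [← h0, this, energy]
  · have hp : IsProb ((μ Set.univ)⁻¹ • μ) := by
      refine ⟨VectorMeasure.le_iff.2 fun s hs => ?_, ?_⟩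
      · have := VectorMeasure.le_iff.1 h.1 s hs
        simp only [FunLike.coe_zero, Pi.zero_apply, FunLike.coe_smul, Pi.smul_apply,
          smul_eq_mul] at this ⊢
        positivity
      · simp [inv_mul_cancel₀ h0.ne']
    rw [D_of_isProb hp, VectorMeasure.variation_smul, energy_smul]
    have e : (((μ Set.univ) ^ 2 : ℝ) : EReal) = ((ENNReal.ofReal (μ Set.univ) ^ 2 : ℝ≥0∞) : EReal) := by
      rw [← ENNReal.ofReal_pow h0.le, EReal.coe_ennreal_ofReal, max_eq_left (by positivity)]
    have e2 : ((‖(μ Set.univ)⁻¹‖₊ : ℝ≥0) : ℝ≥0∞) = (ENNReal.ofReal (μ Set.univ))⁻¹ := by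
      rw [← ENNReal.ofReal_inv_of_pos h0, ← enorm_eq_nnnorm, Real.enorm_eq_ofReal (by positivity)]
    rw [e, ← EReal.coe_ennreal_mul, e2, ← mul_assoc, ← mul_pow, ENNReal.mul_inv_cancel
      (by simpa using h0) ENNReal.ofReal_ne_top, one_pow, one_mul]

theorem D2_of_not_isSubProb {ℓ : ℝ≥0 → ℝ≥0∞} {μ : Meas d} (h : ¬ IsSubProb μ) :
    D2 ℓ μ = ⊤ := if_neg h

theorem D2_of_isProb {ℓ : ℝ≥0 → ℝ≥0∞} {μ : Meas d} (h : IsProb μ) : D2 ℓ μ = D ℓ μ := by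
  rw [D2_of_isSubProb h.isSubProb, D_of_isProb h]

theorem D2_le_D (ℓ : ℝ≥0 → ℝ≥0∞) (μ : Meas d) : D2 ℓ μ ≤ D ℓ μ := by
  by_cases h : IsProb μ
  · exact (D2_of_isProb h).le
  · simp [D_of_not_isProb h]

/-! ### Empirical measures -/

/-- The empirical measure of `N` points. -/
def empirical {N : ℕ} (x : Fin N → Space d) : Measure (Space d) :=
  (N : ℝ≥0∞)⁻¹ • ∑ i, Measure.dirac (x i)

theorem isProbabilityMeasure_empirical {N : ℕ} (hN : 1 ≤ N) (x : Fin N → Space d) :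
    IsProbabilityMeasure (empirical x) :=
  ⟨by simp [empirical, ENNReal.inv_mul_cancel (show (N : ℝ≥0∞) ≠ 0 by simp; omega)]⟩

theorem integral_empirical {N : ℕ} (x : Fin N → Space d) (v : C₀(Space d, ℝ)) :
    ∫ y, v y ∂(empirical x) = (N : ℝ)⁻¹ * ∑ i, v (x i) := by
  rw [empirical, integral_smul_measure, integral_finsetSum_measure fun i _ => integrable_c0 v _]
  simp

theorem energy_empirical {ℓ : ℝ≥0 → ℝ≥0∞} (hℓ : Measurable ℓ) {N : ℕ} (hN : 1 ≤ N)
    (x : Fin N → Space d) :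
    energy ℓ (empirical x) = (N : ℝ≥0∞)⁻¹ * ((N : ℝ≥0∞)⁻¹ * ∑ i, ∑ j, ℓ ‖x i - x j‖₊) := by
  have := isProbabilityMeasure_empirical hN x
  have hint : ∀ f : Space d → ℝ≥0∞, Measurable f →
      ∫⁻ y, f y ∂(empirical x) = (N : ℝ≥0∞)⁻¹ * ∑ i, f (x i) := fun f hf => by
    rw [empirical, lintegral_smul_measure, lintegral_finsetSum_measure, smul_eq_mul]
    simp_rw [lintegral_dirac' _ hf]
  have hm : Measurable fun p : Space d × Space d => ℓ ‖p.1 - p.2‖₊ := by fun_prop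
  rw [energy, lintegral_prod _ hm.aemeasurable]
  dsimp only
  rw [hint _ hm.lintegral_prod_right', Finset.mul_sum]
  simp_rw [fun i => hint (fun y => ℓ ‖x i - y‖₊) (by fun_prop), Finset.mul_sum]

/-- Adding the diagonal terms to the `N`-particle cost changes it by at most `ℓ(0) / N`. -/
theorem energy_empirical_le {ℓ : ℝ≥0 → ℝ≥0∞} (hℓ : Measurable ℓ) {N : ℕ} (hN : 1 ≤ N)
    (x : Fin N → Space d) : energy ℓ (empirical x) ≤ cost ℓ N x + ℓ 0 / N := by
  have hN0 : (N : ℝ≥0∞) ≠ 0 := by simp; omega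
  rw [energy_empirical hℓ hN, cost_eq_sum_erase]
  have : ∀ i, ∑ j, ℓ ‖x i - x j‖₊ = ∑ j ∈ Finset.univ.erase i, ℓ ‖x i - x j‖₊ + ℓ 0 := fun i => by
    rw [← Finset.sum_erase_add _ _ (Finset.mem_univ i), sub_self, nnnorm_zero]
  simp_rw [this, Finset.sum_add_distrib]
  rw [Finset.sum_const, Finset.card_univ, Fintype.card_fin, nsmul_eq_mul, mul_add, mul_add,
    ← mul_assoc (N : ℝ≥0∞)⁻¹ (N : ℝ≥0∞), ENNReal.inv_mul_cancel hN0 (by simp), one_mul,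
    ← mul_assoc, ← ENNReal.mul_inv (by simp) (by simp), div_eq_mul_inv, mul_comm (ℓ 0)]
  gcongr
  rw [Nat.cast_mul]
  gcongr
  omega

/-! ### Bounds for `M_N` -/

theorem ofReal_integral_le_lintegral {Ω : Type*} [MeasurableSpace Ω] {P : Measure Ω} {f : Ω → ℝ}
    (hf : Integrable f P) : ENNReal.ofReal (∫ x, f x ∂P) ≤ ∫⁻ x, ENNReal.ofReal (f x) ∂P := by
  calc ENNReal.ofReal (∫ x, f x ∂P) ≤ ENNReal.ofReal (∫ x, max (f x) 0 ∂P) :=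
        ENNReal.ofReal_le_ofReal (integral_mono hf hf.pos_part fun x => le_max_left _ _)
    _ = ∫⁻ x, ENNReal.ofReal (max (f x) 0) ∂P :=
        ofReal_integral_eq_lintegral_ofReal hf.pos_part (.of_forall fun x => le_max_right _ _)
    _ = _ := by simp

/-- The supremum defining `M_N` is approached by configurations of points: a plan cannot do better
on average than everywhere. -/
theorem exists_config_of_lt_MN {ℓ : ℝ≥0 → ℝ≥0∞} {N : ℕ} (hN : 1 ≤ N) {v : C₀(Space d, ℝ)} {a : ℝ}
    (h : (a : EReal) < MN ℓ N v) :
    ∃ x : Fin N → Space d, cost ℓ N x < ENNReal.ofReal (∫ y, v y ∂(empirical x) - a) := by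
  obtain ⟨μ, hμ⟩ := lt_iSup_iff.1 h
  by_cases hp : IsProb μ
  swap
  · simp [CN_of_not_isProb hp] at hμ
  have := hp.isProbabilityMeasure
  rw [CN_of_isProb hp, coe_lt_coe_sub_iff, otCost] at hμ
  obtain ⟨P, hμ⟩ := iInf_lt_iff.1 hμ
  obtain ⟨hP, hlt⟩ := iInf_lt_iff.1 hμ
  have := hP.1
  by_contra! hcon
  refine hlt.not_ge ?_
  have hvi : ∀ i : Fin N, Integrable (fun x : Fin N → Space d => v (x i)) P := fun i =>
    ((v.toBCF.compContinuous ⟨fun x : Fin N → Space d => x i, continuous_apply i⟩).integrable P)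
  have hvi' : ∀ i : Fin N, ∫ x, v (x i) ∂P = pairing v μ := fun i => by
    rw [pairing_eq_integral hp.1, ← hP.2 i]
    exact (integral_map (measurable_pi_apply i).aemeasurable
      (map_continuous v).aestronglyMeasurable).symm
  have hint : Integrable (fun x : Fin N → Space d => ∫ y, v y ∂(empirical x) - a) P := by
    simp_rw [integral_empirical]
    exact ((integrable_finsetSum _ fun i _ => hvi i).const_mul _).sub (integrable_const _)
  have hN0 : (N : ℝ) ≠ 0 := by simp; omega
  have hval : ∫ x : Fin N → Space d, (∫ y, v y ∂(empirical x) - a) ∂P = pairing v μ - a := by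
    simp_rw [integral_empirical]
    rw [integral_sub ((integrable_finsetSum _ fun i _ => hvi i).const_mul _) (integrable_const _),
      integral_const_mul, integral_finsetSum _ fun i _ => hvi i]
    simp [hvi', hN0]
  rw [← hval]
  exact (ofReal_integral_le_lintegral hint).trans (lintegral_mono hcon)

theorem conj_D_le_MN {ℓ : ℝ≥0 → ℝ≥0∞} (hℓ : Measurable ℓ) (N : ℕ) (v : C₀(Space d, ℝ)) :
    conj (D ℓ) v ≤ MN ℓ N v :=
  iSup_mono fun μ => EReal.sub_le_sub le_rfl (CN_le_D hℓ N μ)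

theorem antitone_MN {ℓ : ℝ≥0 → ℝ≥0∞} (hℓ : Measurable ℓ) (v : C₀(Space d, ℝ)) :
    Antitone fun N => MN ℓ N v := fun _ _ h =>
  iSup_mono fun μ => EReal.sub_le_sub le_rfl (monotone_CN hℓ μ h)

/-- Empirical measures of nearly optimal configurations are competitors for the conjugate of `D`;
this needs `ℓ 0 < ⊤`, as their energy contains the diagonal terms. -/
theorem MN_le_conj_D_add {ℓ : ℝ≥0 → ℝ≥0∞} (hℓ : Measurable ℓ) (h0 : ℓ 0 ≠ ⊤) {N : ℕ} (hN : 1 ≤ N)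
    (v : C₀(Space d, ℝ)) :
    MN ℓ N v ≤ conj (D ℓ) v + (((ℓ 0).toReal / N : ℝ) : EReal) := by
  refine EReal.ge_of_forall_gt_iff_ge.1 fun a ha => ?_
  obtain ⟨x, hx⟩ := exists_config_of_lt_MN hN ha
  have := isProbabilityMeasure_empirical hN x
  set p := ∫ y, v y ∂(empirical x)
  have hpa : 0 < p - a := ENNReal.ofReal_pos.1 (pos_of_gt hx)
  have h1 : ((a - (ℓ 0).toReal / N : ℝ) : EReal) ≤ (p : EReal) - (energy ℓ (empirical x) : EReal) := by
    have hq : 0 ≤ (ℓ 0).toReal / N := by positivity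
    refine coe_le_coe_sub_of_le (by linarith) ?_
    calc _ ≤ cost ℓ N x + ℓ 0 / N := energy_empirical_le hℓ hN x
      _ ≤ ENNReal.ofReal (p - a) + ENNReal.ofReal ((ℓ 0).toReal / N) := by
          gcongr
          rw [ENNReal.ofReal_div_of_pos (by exact_mod_cast hN), ENNReal.ofReal_toReal h0,
            ENNReal.ofReal_natCast]
      _ = _ := by
          rw [← ENNReal.ofReal_add hpa.le hq]
          congr 1; ring
  have h2 := h1.trans (integral_sub_energy_le_conj_D ℓ v _)
  rw [EReal.coe_sub] at h2
  exact (EReal.sub_le_iff_le_add (.inl (by simp)) (.inl (by simp))).1 h2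

/-! ### Far away configurations -/

theorem exists_norm_eq_one (hd : 1 ≤ d) : ∃ e : Space d, ‖e‖ = 1 :=
  ⟨EuclideanSpace.single ⟨0, hd⟩ 1, by simp⟩

theorem exists_radius_cost {ℓ : ℝ≥0 → ℝ≥0∞} (hℓ : Tendsto ℓ atTop (𝓝 0)) {ε : ℝ≥0∞} (hε : 0 < ε) :
    ∃ R : ℝ, 0 ≤ R ∧ ∀ x y : Space d, R ≤ ‖x - y‖ → ℓ ‖x - y‖₊ ≤ ε := by
  obtain ⟨R, hR⟩ := eventually_atTop.1 (hℓ.eventually_le_const hε)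
  exact ⟨R, R.2, fun x y h => hR _ (NNReal.coe_le_coe.1 (by simpa using h))⟩

theorem exists_radius_c0 (v : C₀(Space d, ℝ)) {ε : ℝ} (hε : 0 < ε) :
    ∃ R : ℝ, 0 ≤ R ∧ ∀ x : Space d, R ≤ ‖x‖ → |v x| ≤ ε := by
  have h1 := v.zero_at_infty'
  rw [← Metric.cobounded_eq_cocompact, ← comap_norm_atTop] at h1
  have h2 := h1 (Metric.closedBall_mem_nhds 0 hε)
  obtain ⟨t, ht, hs⟩ := mem_comap.1 (mem_map.1 h2)
  obtain ⟨R, hR⟩ := mem_atTop_sets.1 ht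
  refine ⟨max R 0, le_max_right _ _, fun x hx => ?_⟩
  have : x ∈ _ := hs (hR ‖x‖ (le_trans (le_max_left _ _) hx))
  simpa using this

theorem cost_le_of_pairwise {ℓ : ℝ≥0 → ℝ≥0∞} {N : ℕ} {x : Fin N → Space d} {ε : ℝ≥0∞}
    (h : ∀ i j, i ≠ j → ℓ ‖x i - x j‖₊ ≤ ε) : cost ℓ N x ≤ ε := by
  rw [cost_eq_sum_erase]
  calc _ ≤ ((N * (N - 1) : ℕ) : ℝ≥0∞)⁻¹ * ∑ i : Fin N, ∑ j ∈ Finset.univ.erase i, ε := by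
        gcongr with i _ j hj
        exact h i j (Finset.ne_of_mem_erase hj).symm
    _ = (((N * (N - 1) : ℕ) : ℝ≥0∞)⁻¹ * ((N * (N - 1) : ℕ) : ℝ≥0∞)) * ε := by
        simp [mul_assoc]
    _ ≤ ε := mul_le_of_le_one_left (by simp) (ENNReal.inv_mul_le_one _)

/-- The uniform mixture of the cyclic shifts of a configuration has the empirical measure as all
of its marginals. -/
theorem otCost_empirical_le {ℓ : ℝ≥0 → ℝ≥0∞} (hℓ : Measurable ℓ) {N : ℕ} (hN : 1 ≤ N)
    {x : Fin N → Space d} {ε : ℝ≥0∞} (h : ∀ i j, i ≠ j → ℓ ‖x i - x j‖₊ ≤ ε) :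
    otCost ℓ N (empirical x) ≤ ε := by
  have : NeZero N := ⟨by omega⟩
  have hN0 : (N : ℝ≥0∞) ≠ 0 := by simp; omega
  let P : Measure (Fin N → Space d) :=
    (N : ℝ≥0∞)⁻¹ • ∑ k : Fin N, Measure.dirac fun i => x (i + k)
  have hP : IsProbabilityMeasure P := ⟨by simp [P, ENNReal.inv_mul_cancel hN0]⟩
  have hmarg : ∀ j : Fin N, P.map (fun y => y j) = empirical x := fun j => by
    ext s hs
    rw [Measure.map_apply (measurable_pi_apply j) hs]
    have hs' : MeasurableSet ((fun y : Fin N → Space d => y j) ⁻¹' s) := measurable_pi_apply j hs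
    simp only [P, empirical, Measure.smul_apply, Measure.finsetSum_apply,
      Measure.dirac_apply' _ hs, Measure.dirac_apply' _ hs']
    congr 1
    exact Equiv.sum_comp (Equiv.addLeft j) fun i => s.indicator (1 : Space d → ℝ≥0∞) (x i)
  refine (iInf₂_le P ⟨hP, hmarg⟩).trans ?_
  calc ∫⁻ y, cost ℓ N y ∂P ≤ ∫⁻ _, ε ∂P := by
        simp only [P]
        rw [lintegral_smul_measure, lintegral_smul_measure, lintegral_finsetSum_measure,
          lintegral_finsetSum_measure]
        simp_rw [lintegral_dirac' _ (measurable_cost hℓ N), lintegral_dirac' _ measurable_const]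
        gcongr with k
        exact cost_le_of_pairwise fun i j hij => h _ _ (by simpa using hij)
    _ = ε := by simp

/-- Particles far from the origin and from each other have negligible cost and potential. -/
theorem MN_nonneg {ℓ : ℝ≥0 → ℝ≥0∞} (hd : 1 ≤ d) (hm : Measurable ℓ) (hℓ : Tendsto ℓ atTop (𝓝 0))
    {N : ℕ} (hN : 1 ≤ N) (v : C₀(Space d, ℝ)) : 0 ≤ MN ℓ N v := by
  refine EReal.ge_of_forall_gt_iff_ge.1 fun a ha => ?_
  have ha : a < 0 := by exact_mod_cast ha
  obtain ⟨e, he⟩ := exists_norm_eq_one hd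
  obtain ⟨R, hR0, hR⟩ := exists_radius_cost (d := d) hℓ (ε := ENNReal.ofReal (-a / 2))
    (by rw [ENNReal.ofReal_pos]; linarith)
  obtain ⟨S, hS0, hS⟩ := exists_radius_c0 v (ε := -a / 2) (by linarith)
  -- Collinear points at distances `R + S` from the origin and from each other.
  let x : Fin N → Space d := fun i => ((R + S) * (i + 1 : ℝ)) • e
  have := isProbabilityMeasure_empirical hN x
  have hpair : ∀ i j, i ≠ j → ℓ ‖x i - x j‖₊ ≤ ENNReal.ofReal (-a / 2) := fun i j hij => by
    refine hR _ _ ?_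
    have h1 : (1 : ℝ) ≤ |(i : ℝ) - j| := by
      have : (1 : ℤ) ≤ |(i : ℤ) - j| := Int.one_le_abs (by
        rw [sub_ne_zero]; exact_mod_cast Fin.val_ne_of_ne hij)
      exact_mod_cast this
    rw [← sub_smul, norm_smul, he, mul_one, ← mul_sub, Real.norm_eq_abs, abs_mul,
      abs_of_nonneg (by positivity), add_sub_add_right_eq_sub]
    nlinarith
  have hv : a / 2 ≤ ∫ y, v y ∂(empirical x) := by
    rw [integral_empirical]
    have : ∑ i : Fin N, (a / 2) ≤ ∑ i, v (x i) := Finset.sum_le_sum fun i _ => by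
      have := (abs_le.1 (hS (x i) ?_)).1
      · linarith
      · rw [norm_smul, he, mul_one, Real.norm_eq_abs, abs_of_nonneg (by positivity)]
        have : (0 : ℝ) ≤ i := by positivity
        nlinarith
    have hN' : (0 : ℝ) < N := by exact_mod_cast hN
    rw [Finset.sum_const, Finset.card_univ, Fintype.card_fin, nsmul_eq_mul] at this
    rw [inv_mul_eq_div, le_div_iff₀ hN']
    linarith
  refine le_trans ?_ (le_iSup _ (empirical x).toSignedMeasure)
  rw [CN_of_isProb (isProb_toSignedMeasure _), pairing_toSignedMeasure,
    Measure.variation_toSignedMeasure]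
  refine coe_le_coe_sub_of_le (by linarith) ((otCost_empirical_le hm hN hpair).trans
    (ENNReal.ofReal_le_ofReal (by linarith)))

/-! ### Convexity of `C_N` -/

theorem CN_nonneg (ℓ : ℝ≥0 → ℝ≥0∞) (N : ℕ) (μ : Meas d) : 0 ≤ CN ℓ N μ := by
  by_cases h : IsProb μ
  · rw [CN_of_isProb h]; exact EReal.coe_ennreal_nonneg _
  · simp [CN_of_not_isProb h]

theorem isProb_convexCombination {μ ν : Meas d} (hμ : IsProb μ) (hν : IsProb ν) {a b : ℝ}
    (ha : 0 ≤ a) (hb : 0 ≤ b) (hab : a + b = 1) :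
    IsProb (a • μ + b • ν) := by
  refine ⟨VectorMeasure.le_iff.2 fun s hs => ?_, ?_⟩
  · have h1 := VectorMeasure.le_iff.1 hμ.1 s hs
    have h2 := VectorMeasure.le_iff.1 hν.1 s hs
    simp only [FunLike.coe_zero, Pi.zero_apply, add_apply, FunLike.coe_smul, Pi.smul_apply,
      smul_eq_mul] at h1 h2 ⊢
    positivity
  · simp [hμ.2, hν.2, hab]

theorem variation_convexCombination {μ ν : Meas d} (hμ : 0 ≤ μ) (hν : 0 ≤ ν) (a b : ℝ≥0) :
    ((a : ℝ) • μ + (b : ℝ) • ν).variation = a • μ.variation + b • ν.variation := by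
  conv_lhs => rw [← toSignedMeasure_variation hμ, ← toSignedMeasure_variation hν]
  have : (a : ℝ) • μ.variation.toSignedMeasure + (b : ℝ) • ν.variation.toSignedMeasure
      = (a • μ.variation + b • ν.variation).toSignedMeasure := by
    rw [Measure.toSignedMeasure_add, Measure.toSignedMeasure_smul, Measure.toSignedMeasure_smul]
    rfl
  rw [this, Measure.variation_toSignedMeasure]

theorem otCost_convexCombination_le (ℓ : ℝ≥0 → ℝ≥0∞) (N : ℕ) (m n : Measure (Space d)) (a b : ℝ≥0)
    (hab : a + b = 1) :
    otCost ℓ N (a • m + b • n) ≤ a * otCost ℓ N m + b * otCost ℓ N n := by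
  by_cases ha : a = 0
  · simp [ha, show b = 1 by simpa [ha] using hab]
  by_cases hb : b = 0
  · simp [hb, show a = 1 by simpa [hb] using hab]
  have key : ∀ P ∈ plans N m, ∀ Q ∈ plans N n, otCost ℓ N (a • m + b • n)
      ≤ a * ∫⁻ x, cost ℓ N x ∂P + b * ∫⁻ x, cost ℓ N x ∂Q := fun P hP Q hQ => by
    have := hP.1
    have := hQ.1
    have hmem : a • P + b • Q ∈ plans N (a • m + b • n) := by
      refine ⟨⟨?_⟩, fun j => ?_⟩
      · simp only [Measure.add_apply, Measure.smul_apply, measure_univ, ENNReal.smul_def,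
          smul_eq_mul, mul_one]
        exact_mod_cast hab
      · rw [Measure.map_add _ _ (measurable_pi_apply j), Measure.map_smul, Measure.map_smul,
          hP.2 j, hQ.2 j]
    refine (iInf₂_le _ hmem).trans_eq ?_
    rw [lintegral_add_measure, lintegral_smul_measure, lintegral_smul_measure]
    rfl
  rw [otCost.eq_1 ℓ N m, otCost.eq_1 ℓ N n, iInf_subtype', iInf_subtype',
    ENNReal.mul_iInf_of_ne (by simpa using ha) (by simp),
    ENNReal.mul_iInf_of_ne (by simpa using hb) (by simp)]
  refine ENNReal.le_iInf_add_iInf ?_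
  exact fun P Q => key P.1 P.2 Q.1 Q.2

theorem coe_ennreal_le_coe_iff {c : ℝ≥0∞} {r : ℝ} :
    (c : EReal) ≤ (r : EReal) ↔ 0 ≤ r ∧ c ≤ ENNReal.ofReal r := by
  constructor
  · intro h
    have hr : (0 : ℝ) ≤ r := by exact_mod_cast (EReal.coe_ennreal_nonneg c).trans h
    refine ⟨hr, ?_⟩
    rw [← EReal.coe_ennreal_le_coe_ennreal_iff, EReal.coe_ennreal_ofReal, max_eq_left hr]
    exact h
  · rintro ⟨hr, h⟩
    rwa [← EReal.coe_ennreal_le_coe_ennreal_iff, EReal.coe_ennreal_ofReal, max_eq_left hr] at h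

theorem isConvex_CN (ℓ : ℝ≥0 → ℝ≥0∞) (N : ℕ) : IsConvex (CN (d := d) ℓ N) := by
  rintro ⟨μ, s⟩ hμ ⟨ν, t⟩ hν a b ha hb hab
  have hprob : ∀ {κ : Meas d} {r : ℝ}, CN ℓ N κ ≤ r → IsProb κ := fun {κ r} h => by
    by_contra hκ
    simp [CN_of_not_isProb hκ] at h
  have hμ' : CN ℓ N μ ≤ s := hμ
  have hν' : CN ℓ N ν ≤ t := hν
  have h1 := hprob hμ'
  have h2 := hprob hν'
  change CN ℓ N (a • μ + b • ν) ≤ ((a * s + b * t : ℝ) : EReal)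
  rw [CN_of_isProb h1, coe_ennreal_le_coe_iff] at hμ'
  rw [CN_of_isProb h2, coe_ennreal_le_coe_iff] at hν'
  have := hμ'.1
  have := hν'.1
  rw [CN_of_isProb (isProb_convexCombination h1 h2 ha hb hab), coe_ennreal_le_coe_iff]
  refine ⟨by positivity, ?_⟩
  lift a to ℝ≥0 using ha
  lift b to ℝ≥0 using hb
  rw [variation_convexCombination h1.1 h2.1, ENNReal.ofReal_add (by positivity) (by positivity),
    ENNReal.ofReal_mul (by positivity), ENNReal.ofReal_mul (by positivity),
    ENNReal.ofReal_coe_nnreal, ENNReal.ofReal_coe_nnreal]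
  refine (otCost_convexCombination_le ℓ N _ _ a b (by exact_mod_cast hab)).trans ?_
  gcongr
  exacts [hμ'.2, hν'.2]

/-! ### Sending mass to infinity -/

/-- The mutual interaction energy of two measures. -/
def mutualEnergy (ℓ : ℝ≥0 → ℝ≥0∞) (m n : Measure (Space d)) : ℝ≥0∞ :=
  ∫⁻ p, ℓ ‖p.1 - p.2‖₊ ∂(m.prod n)

theorem energy_add_smul (ℓ : ℝ≥0 → ℝ≥0∞) (m n : Measure (Space d)) [SFinite m] [SFinite n]
    (c : ℝ≥0) :
    energy ℓ (m + c • n) = energy ℓ m + c * mutualEnergy ℓ m n + c * mutualEnergy ℓ n m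
      + c ^ 2 * energy ℓ n := by
  simp only [energy, mutualEnergy]
  rw [Measure.prod_add, Measure.add_prod, Measure.add_prod, Measure.prod_smul_left,
    Measure.prod_smul_right, Measure.prod_smul_left, Measure.prod_smul_right,
    lintegral_add_measure, lintegral_add_measure, lintegral_add_measure]
  simp only [lintegral_smul_measure, ENNReal.smul_def, smul_eq_mul]
  ring

/-- The measure `m` gives no mass to the complement of some ball. -/
def HasBoundedSupport (m : Measure (Space d)) : Prop :=
  ∃ A : ℝ, ∀ᵐ x ∂m, ‖x‖ ≤ A

theorem mutualEnergy_le {ℓ : ℝ≥0 → ℝ≥0∞} {m n : Measure (Space d)} [IsFiniteMeasure m]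
    [IsFiniteMeasure n] (hm : m Set.univ ≤ 1) (hn : n Set.univ ≤ 1) {s t : Set (Space d)}
    (hs : ∀ᵐ x ∂m, x ∈ s) (ht : ∀ᵐ x ∂n, x ∈ t) {ε : ℝ≥0∞}
    (h : ∀ x ∈ s, ∀ y ∈ t, ℓ ‖x - y‖₊ ≤ ε) : mutualEnergy ℓ m n ≤ ε := by
  have h1 : ∀ᵐ p ∂(m.prod n), p.1 ∈ s := Measure.quasiMeasurePreserving_fst.ae hs
  have h2 : ∀ᵐ p ∂(m.prod n), p.2 ∈ t := Measure.quasiMeasurePreserving_snd.ae ht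
  calc mutualEnergy ℓ m n ≤ ∫⁻ _, ε ∂(m.prod n) := by
        refine lintegral_mono_ae ?_
        filter_upwards [h1, h2] with p hp1 hp2 using h _ hp1 _ hp2
    _ = ε * (m Set.univ * n Set.univ) := by
        rw [lintegral_const, ← Set.univ_prod_univ, Measure.prod_prod]
    _ ≤ ε * (1 * 1) := by gcongr
    _ = ε := by simp

/-- Far away translates interact neither with a given measure nor with a given test function. -/
theorem exists_far_translate {ℓ : ℝ≥0 → ℝ≥0∞} (hd : 1 ≤ d) (hℓm : Measurable ℓ)
    (hℓ : Tendsto ℓ atTop (𝓝 0)) (v : C₀(Space d, ℝ)) {m σ : Measure (Space d)}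
    [IsFiniteMeasure m] [IsProbabilityMeasure σ] (hm1 : m Set.univ ≤ 1)
    (hm : HasBoundedSupport m) (hσ : HasBoundedSupport σ) {ε : ℝ≥0} (hε : 0 < ε) :
    ∃ τ : Measure (Space d), IsProbabilityMeasure τ ∧ HasBoundedSupport τ ∧
      energy ℓ τ = energy ℓ σ ∧ mutualEnergy ℓ m τ ≤ ε ∧ mutualEnergy ℓ τ m ≤ ε ∧
      -(ε : ℝ) ≤ ∫ x, v x ∂τ := by
  obtain ⟨A, hA⟩ := hm
  obtain ⟨B, hB⟩ := hσ
  obtain ⟨e, he⟩ := exists_norm_eq_one hd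
  obtain ⟨R, hR0, hR⟩ := exists_radius_cost (d := d) hℓ (ε := ε) (by exact_mod_cast hε)
  obtain ⟨S, hS0, hS⟩ := exists_radius_c0 v (ε := ε) (by exact_mod_cast hε)
  -- Translating by `T` puts the support of `σ` at distance `R` from that of `m`, and at distance
  -- `S` from the origin.
  set T : ℝ := |A| + |B| + R + S with hT
  have hT0 : 0 ≤ T := by positivity
  have hTe : ‖T • e‖ = T := by rw [norm_smul, he, mul_one, Real.norm_of_nonneg hT0]
  have hadd : Measurable fun x : Space d => x + T • e := measurable_add_const _
  have hτ : IsProbabilityMeasure (σ.map fun x => x + T • e) :=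
    Measure.isProbabilityMeasure_map hadd.aemeasurable
  have hae : ∀ᵐ y ∂(σ.map fun x => x + T • e), ‖y - T • e‖ ≤ |B| := by
    rw [ae_map_iff hadd.aemeasurable (measurableSet_le (by fun_prop) (by fun_prop))]
    filter_upwards [hB] with x hx
    simpa using hx.trans (le_abs_self B)
  have hlow : ∀ y : Space d, ‖y - T • e‖ ≤ |B| → T - |B| ≤ ‖y‖ := fun y hy => by
    have := norm_sub_norm_le (T • e) (T • e - y)
    rw [sub_sub_cancel, norm_sub_rev, hTe] at this
    linarith
  have hfar : ∀ x ∈ {x : Space d | ‖x‖ ≤ |A|}, ∀ y ∈ {y : Space d | ‖y - T • e‖ ≤ |B|},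
      R ≤ ‖x - y‖ := fun x hx y hy => by
    have h1 := norm_sub_norm_le y x
    rw [norm_sub_rev] at h1
    have h2 := hlow y hy
    have h3 : ‖x‖ ≤ |A| := hx
    linarith
  have hA' : ∀ᵐ x ∂m, x ∈ {x : Space d | ‖x‖ ≤ |A|} := by
    filter_upwards [hA] with x hx using hx.trans (le_abs_self A)
  refine ⟨σ.map fun x => x + T • e, hτ, ⟨|B| + T, ?_⟩, ?_, ?_, ?_, ?_⟩
  · filter_upwards [hae] with y hy
    have := norm_le_norm_add_norm_sub (T • e) y
    rw [hTe, norm_sub_rev] at this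
    linarith
  · rw [energy, Measure.map_prod_map _ _ hadd hadd, lintegral_map (by fun_prop) (by fun_prop)]
    simp [energy]
  · exact mutualEnergy_le hm1 prob_le_one hA' hae fun x hx y hy => hR x y (hfar x hx y hy)
  · exact mutualEnergy_le prob_le_one hm1 hae hA' fun x hx y hy =>
      hR x y (by rw [norm_sub_rev]; exact hfar y hy x hx)
  · have : ∫ _, -(ε : ℝ) ∂(σ.map fun x => x + T • e) ≤ ∫ x, v x ∂(σ.map fun x => x + T • e) := by
      refine integral_mono_ae (integrable_const _) (integrable_c0 v _) ?_
      filter_upwards [hae] with y hy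
      refine (abs_le.1 (hS y ?_)).1
      have := hlow y hy
      have := abs_nonneg A
      linarith
    simpa using this

/-- Mass can be added in `n` equal parts, far away from each other, each of which costs only its
self-interaction. -/
theorem exists_add_mass {ℓ : ℝ≥0 → ℝ≥0∞} (hd : 1 ≤ d) (hℓm : Measurable ℓ)
    (hℓ : Tendsto ℓ atTop (𝓝 0)) (v : C₀(Space d, ℝ)) {m σ : Measure (Space d)}
    [IsProbabilityMeasure σ] (hm : HasBoundedSupport m)
    (hσ : HasBoundedSupport σ) {ε : ℝ≥0} (hε : 0 < ε) {δ : ℝ≥0} (hδ : δ ≤ 1) (n : ℕ)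
    (hmass : m Set.univ + n * δ ≤ 1) :
    ∃ m' : Measure (Space d), HasBoundedSupport m' ∧ m' Set.univ = m Set.univ + n * δ ∧
      energy ℓ m' ≤ energy ℓ m + n * (δ ^ 2 * energy ℓ σ + 2 * ε) ∧
      ∫ x, v x ∂m - n * ε ≤ ∫ x, v x ∂m' := by
  induction n with
  | zero => exact ⟨m, hm, by simp, by simp, by simp⟩
  | succ n ih =>
    obtain ⟨m', hm', hmass', hE, hv⟩ := ih (le_trans (by gcongr; simp) hmass)
    have hle : m' Set.univ ≤ 1 := by
      rw [hmass']; exact le_trans (by gcongr; simp) hmass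
    have : IsFiniteMeasure m' := ⟨hle.trans_lt ENNReal.one_lt_top⟩
    obtain ⟨τ, hτ, ⟨B, hB⟩, hτE, h1, h2, h3⟩ := exists_far_translate hd hℓm hℓ v hle hm' hσ hε
    obtain ⟨A, hA⟩ := hm'
    have hδ' : (δ : ℝ≥0∞) ≤ 1 := by exact_mod_cast hδ
    refine ⟨m' + δ • τ, ⟨max A B, ?_⟩, ?_, ?_, ?_⟩
    · rw [ae_add_measure_iff]
      constructor
      · filter_upwards [hA] with x hx using hx.trans (le_max_left _ _)
      · refine Measure.ae_smul_measure ?_ δ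
        filter_upwards [hB] with x hx using hx.trans (le_max_right _ _)
    · rw [Measure.add_apply, hmass', Measure.smul_apply, measure_univ (μ := τ),
        ENNReal.smul_def, smul_eq_mul]
      push_cast
      ring
    · rw [energy_add_smul, hτE]
      calc energy ℓ m' + δ * mutualEnergy ℓ m' τ + δ * mutualEnergy ℓ τ m' + δ ^ 2 * energy ℓ σ
          ≤ energy ℓ m + n * (δ ^ 2 * energy ℓ σ + 2 * ε) + 1 * ε + 1 * ε
              + δ ^ 2 * energy ℓ σ := by gcongr
        _ = _ := by push_cast; ring
    · rw [integral_add_measure (integrable_c0 v _) (integrable_c0 v _),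
        integral_smul_nnreal_measure, NNReal.smul_def, smul_eq_mul]
      have hδr : (δ : ℝ) ≤ 1 := hδ
      have hδ0 : (0 : ℝ) ≤ δ := δ.2
      have hε0 : (0 : ℝ) ≤ ε := ε.2
      push_cast
      nlinarith

theorem energy_mono (ℓ : ℝ≥0 → ℝ≥0∞) {m n : Measure (Space d)} [SFinite n] [SFinite m] (h : m ≤ n) :
    energy ℓ m ≤ energy ℓ n :=
  lintegral_mono' (Measure.prod_mono h h) le_rfl

theorem tendsto_setIntegral_closedBall (v : C₀(Space d, ℝ)) (m : Measure (Space d))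
    [IsFiniteMeasure m] :
    Tendsto (fun k : ℕ => ∫ x in Metric.closedBall 0 k, v x ∂m) atTop (𝓝 (∫ x, v x ∂m)) := by
  have := tendsto_setIntegral_of_monotone (μ := m) (f := v)
    (s := fun k : ℕ => Metric.closedBall (0 : Space d) k) (fun k => measurableSet_closedBall)
    (fun i j hij => Metric.closedBall_subset_closedBall (by exact_mod_cast hij))
    ((integrable_c0 v m).integrableOn)
  rwa [Metric.iUnion_closedBall_nat, setIntegral_univ] at this

theorem hasBoundedSupport_restrict_closedBall (m : Measure (Space d)) (A : ℝ) :
    HasBoundedSupport (m.restrict (Metric.closedBall 0 A)) :=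
  ⟨A, by
    filter_upwards [ae_restrict_mem measurableSet_closedBall] with x hx
    simpa using hx⟩

/-- A probability of finite energy can be localised. -/
theorem exists_hasBoundedSupport_energy_lt_top {ℓ : ℝ≥0 → ℝ≥0∞} {σ : Measure (Space d)}
    [IsProbabilityMeasure σ] (h : energy ℓ σ ≠ ⊤) :
    ∃ τ : Measure (Space d), IsProbabilityMeasure τ ∧ HasBoundedSupport τ ∧ energy ℓ τ ≠ ⊤ := by
  have : ∃ k : ℕ, σ (Metric.closedBall 0 k) ≠ 0 := by
    by_contra! hcon
    have := measure_iUnion_null hcon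
    rw [Metric.iUnion_closedBall_nat] at this
    simp at this
  obtain ⟨k, hk⟩ := this
  obtain ⟨c, hc⟩ : ∃ c : ℝ≥0, (c : ℝ≥0∞) = (σ (Metric.closedBall 0 k))⁻¹ :=
    ⟨_, ENNReal.coe_toNNReal (ENNReal.inv_ne_top.2 hk)⟩
  obtain ⟨A, hA⟩ := hasBoundedSupport_restrict_closedBall σ k
  refine ⟨c • σ.restrict (Metric.closedBall 0 k), ⟨?_⟩, ⟨A, Measure.ae_smul_measure hA c⟩, ?_⟩
  · rw [Measure.smul_apply, ENNReal.smul_def, hc, Measure.restrict_apply_univ, smul_eq_mul,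
      ENNReal.inv_mul_cancel hk (measure_ne_top _ _)]
  · rw [energy_smul]
    exact ENNReal.mul_ne_top (by simp) (ne_top_of_le_ne_top h (energy_mono ℓ Measure.restrict_le_self))

/-- The mass missing from a sub-probability can be placed at infinity at an arbitrarily small
cost, so sub-probabilities do not improve on the conjugate of `D`. -/
theorem integral_sub_energy_le_conj_D_of_le_one {ℓ : ℝ≥0 → ℝ≥0∞} (hd : 1 ≤ d) (hℓm : Measurable ℓ)
    (hℓ : Tendsto ℓ atTop (𝓝 0)) (v : C₀(Space d, ℝ)) {σ : Measure (Space d)}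
    [IsProbabilityMeasure σ] (hσ : energy ℓ σ ≠ ⊤) {m : Measure (Space d)} (hm : m Set.univ ≤ 1) :
    ((∫ x, v x ∂m : ℝ) : EReal) - (energy ℓ m : EReal) ≤ conj (D ℓ) v := by
  refine EReal.ge_of_forall_gt_iff_ge.1 fun a ha => ?_
  rw [coe_lt_coe_sub_iff] at ha
  have hfin : IsFiniteMeasure m := ⟨hm.trans_lt ENNReal.one_lt_top⟩
  obtain ⟨τ, hτ, hτb, hτE⟩ := exists_hasBoundedSupport_energy_lt_top hσ
  set p := ∫ x, v x ∂m
  have hEt : energy ℓ m ≠ ⊤ := ha.ne_top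
  obtain ⟨E, hE⟩ : ∃ E : ℝ≥0, (E : ℝ≥0∞) = energy ℓ m := ⟨_, ENNReal.coe_toNNReal hEt⟩
  obtain ⟨F, hF⟩ : ∃ F : ℝ≥0, (F : ℝ≥0∞) = energy ℓ τ := ⟨_, ENNReal.coe_toNNReal hτE⟩
  have hgap : (E : ℝ) < p - a := by
    rw [← hE, ← ENNReal.ofReal_coe_nnreal,
      ENNReal.ofReal_lt_ofReal_iff_of_nonneg (NNReal.coe_nonneg E)] at ha
    exact ha
  obtain ⟨η, hη0, hη⟩ : ∃ η : ℝ≥0, 0 < η ∧ (E : ℝ) + 5 * η ≤ p - a :=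
    ⟨((p - a - E) / 5).toNNReal, by simpa using hgap, by
      rw [Real.coe_toNNReal _ (by linarith)]; linarith⟩
  obtain ⟨k, hk⟩ := ((tendsto_setIntegral_closedBall v m).eventually_const_lt
    (show p - η < p by simpa using hη0)).exists
  -- The budget `5 η` pays `η` for the localisation of `m`, `η` for the potential of the added mass,
  -- and `3 η` for its energy: the self-interaction `θ ^ 2 * F / n` of the `n` pieces, at most `η`,
  -- and their mutual interactions, at most `2 η`.
  set m0 := m.restrict (Metric.closedBall 0 (k : ℝ))
  have hm0 : m0 Set.univ ≤ 1 := (Measure.restrict_le_self _).trans hm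
  obtain ⟨θ, hθ⟩ : ∃ θ : ℝ≥0, (θ : ℝ≥0∞) = 1 - m0 Set.univ :=
    ⟨_, ENNReal.coe_toNNReal (ENNReal.sub_ne_top ENNReal.one_ne_top)⟩
  have hθ1 : θ ≤ 1 := by
    rw [← ENNReal.coe_le_coe, hθ]; exact tsub_le_self
  obtain ⟨n, hn⟩ := exists_nat_gt (F / η)
  have hnpos : (0 : ℝ≥0) < n := lt_of_le_of_lt (by positivity) hn
  have hn1 : (1 : ℝ≥0) ≤ n := by
    have : 0 < n := by exact_mod_cast hnpos
    exact_mod_cast this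
  have hnθ : (n : ℝ≥0∞) * ((θ / n : ℝ≥0) : ℝ≥0∞) = 1 - m0 Set.univ := by
    rw [← hθ]
    exact_mod_cast mul_div_cancel₀ θ hnpos.ne'
  have hsum : m0 Set.univ + n * ((θ / n : ℝ≥0) : ℝ≥0∞) = 1 := by
    rw [hnθ, add_tsub_cancel_of_le hm0]
  obtain ⟨m', -, hm'1, hm'E, hm'v⟩ := exists_add_mass hd hℓm hℓ v
    (hasBoundedSupport_restrict_closedBall m k) hτb (ε := η / n) (by positivity) (δ := θ / n)
    ((div_le_one hnpos).2 (hθ1.trans hn1)) n hsum.le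
  have hprob : IsProbabilityMeasure m' := ⟨hm'1.trans hsum⟩
  have hE' : energy ℓ m' ≤ ENNReal.ofReal (E + 3 * η) := by
    refine hm'E.trans ?_
    have h0 : energy ℓ m0 ≤ E := hE ▸ energy_mono ℓ Measure.restrict_le_self
    have h1 : (n : ℝ≥0) * ((θ / n) ^ 2 * F + 2 * (η / n)) ≤ 3 * η := by
      have h2 : (n : ℝ≥0) * ((θ / n) ^ 2 * F + 2 * (η / n)) = θ ^ 2 * (F / n) + 2 * η := by
        field_simp
      have h3 : F / n ≤ η := by
        rw [div_lt_iff₀ hη0] at hn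
        rw [div_le_iff₀ hnpos, mul_comm]
        exact hn.le
      calc _ = θ ^ 2 * (F / n) + 2 * η := h2
        _ ≤ 1 ^ 2 * η + 2 * η := by gcongr
        _ = 3 * η := by ring
    rw [← hF]
    calc _ ≤ (E : ℝ≥0∞) + ((3 * η : ℝ≥0) : ℝ≥0∞) := by
          gcongr
          exact_mod_cast h1
      _ = _ := by
          rw [← ENNReal.coe_add, ← ENNReal.ofReal_coe_nnreal]
          push_cast; rfl
  have hnη : (n : ℝ) * ((η / n : ℝ≥0) : ℝ) = η := by
    exact_mod_cast mul_div_cancel₀ η hnpos.ne'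
  rw [hnη] at hm'v
  have hp' : p - 2 * η ≤ ∫ x, v x ∂m' := by linarith
  have hη0' : (0 : ℝ) < η := hη0
  have hE0 : (0 : ℝ) ≤ E := E.2
  exact (coe_le_coe_sub_of_le (by linarith) (hE'.trans
    (ENNReal.ofReal_le_ofReal (by linarith)))).trans (integral_sub_energy_le_conj_D ℓ v m')

/-! ### The Fenchel-Moreau theorem for functionals on sub-probabilities -/

/-- An affine minorant of `F` is a minorant of its biconjugate. -/
theorem coe_sub_le_biconj {F : Meas d → EReal} (h0 : ∀ μ, 0 ≤ F μ) {w : C₀(Space d, ℝ)} {r : ℝ}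
    (h : ∀ (ρ : Meas d) (t : ℝ), F ρ ≤ t → pairing w ρ - t ≤ r) (μ : Meas d) :
    ((pairing w μ - r : ℝ) : EReal) ≤ biconj F μ := by
  have hconj : conj F w ≤ r := iSup_le fun ρ => by
    have := h0 ρ
    generalize hx : F ρ = x at this
    induction x with
    | bot => simp at this
    | top => simp
    | coe t => exact_mod_cast h ρ t hx.le
  refine le_trans ?_ (le_iSup _ w)
  rw [EReal.coe_sub]
  exact EReal.sub_le_sub le_rfl hconj

/-- A point strictly above the graph of the biconjugate is approximated by points of the epigraph, as
far as finitely many test functions can see. Restricting to finitely many test functions reduces the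
matter to separation of a point from a convex set in a finite-dimensional space, where every linear
functional comes from a linear combination of the test functions. -/
theorem exists_epigraph_near {F : Meas d → EReal} (h0 : ∀ μ, 0 ≤ F μ) (hc : IsConvex F) {μ : Meas d}
    {a : ℝ} (h : biconj F μ < a) {k : ℕ} (w : Fin k → C₀(Space d, ℝ)) {ε : ℝ} (hε : 0 < ε) :
    ∃ (ρ : Meas d) (t : ℝ), F ρ ≤ t ∧ t < a + ε ∧
      ∀ i, |pairing (w i) ρ - pairing (w i) μ| < ε := by
  by_contra! hcon
  let L : Meas d →ₗ[ℝ] (Fin k → ℝ) := LinearMap.pi fun i => pairingBilin (w i)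
  let T : Meas d × ℝ →ₗ[ℝ] (Fin k → ℝ) × ℝ := L.prodMap LinearMap.id
  set E : Set (Meas d × ℝ) := {p | F p.1 ≤ (p.2 : EReal)}
  have hconv : Convex ℝ (closure (T '' E)) := (hc.linear_image T).closure
  have hnot : T (μ, a) ∉ closure (T '' E) := fun hmem => by
    obtain ⟨-, ⟨⟨ρ, t⟩, hρ, rfl⟩, hdist⟩ := Metric.mem_closure_iff.1 hmem ε hε
    rw [Prod.dist_eq, max_lt_iff] at hdist
    obtain ⟨h1, h2⟩ := hdist
    have ht : t < a + ε := by
      have : |a - t| < ε := h2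
      linarith [(abs_lt.1 this).1]
    obtain ⟨i, hi⟩ := hcon ρ t hρ ht
    have h3 := (dist_pi_lt_iff hε).1 h1 i
    rw [dist_comm] at h3
    exact absurd h3 (not_lt.2 hi)
  obtain ⟨f, u, hfu, huf⟩ := geometric_hahn_banach_closed_point hconv isClosed_closure hnot
  -- The separating functional is `(y, t) ↦ ∑ i, cᵢ yᵢ + s t`, that is, `ρ, t ↦ ⟨v, ρ⟩ + s t`.
  set s : ℝ := f (0, 1) with hs
  set v : C₀(Space d, ℝ) := ∑ i, f (Pi.single i 1, 0) • w i with hv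
  have hf : ∀ (ρ : Meas d) (t : ℝ), f (T (ρ, t)) = pairing v ρ + s * t := fun ρ t => by
    have e1 : T (ρ, t) = ∑ i, pairing (w i) ρ • ((Pi.single i 1, 0) : (Fin k → ℝ) × ℝ)
        + t • ((0, 1) : (Fin k → ℝ) × ℝ) := by
      refine Prod.ext ?_ ?_
      · ext j
        simp [T, L, pairing_eq_pairingBilin, Prod.fst_sum, Finset.sum_apply, Pi.single_apply]
      · simp [T, Prod.snd_sum]
    rw [e1, map_add, map_sum, hv, pairing_eq_pairingBilin, map_sum]
    simp only [map_smul, smul_eq_mul, LinearMap.sum_apply, LinearMap.smul_apply, hs,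
      ← pairing_eq_pairingBilin, mul_comm]
  rw [hf] at huf
  have hE : ∀ (ρ : Meas d) (t : ℝ), F ρ ≤ t → pairing v ρ + s * t < u := fun ρ t hρ => by
    rw [← hf]
    exact hfu _ (subset_closure ⟨(ρ, t), hρ, rfl⟩)
  by_cases hemp : ∃ (ρ : Meas d) (t : ℝ), F ρ ≤ t
  swap
  · -- `F` is identically `⊤`, and every affine function is a minorant.
    push Not at hemp
    have := coe_sub_le_biconj h0 (w := 0) (r := -a) (fun ρ t hρ => absurd hρ (hemp ρ t).not_ge) μ
    rw [pairing_eq_pairingBilin, map_zero] at this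
    simp only [LinearMap.zero_apply, zero_sub, neg_neg] at this
    exact absurd h (not_lt.2 this)
  obtain ⟨ρ₀, t₀, h₀⟩ := hemp
  have hs0 : s ≤ 0 := by
    by_contra! hpos
    have h1 := hE ρ₀ (max t₀ ((u - pairing v ρ₀) / s)) (h₀.trans (by exact_mod_cast le_max_left _ _))
    have h2 : s * ((u - pairing v ρ₀) / s) ≤ s * max t₀ ((u - pairing v ρ₀) / s) := by
      gcongr; exact le_max_right _ _
    rw [mul_div_cancel₀ _ hpos.ne'] at h2
    linarith
  have hsmul : ∀ (c : ℝ) (ρ : Meas d), pairing (c • v) ρ = c * pairing v ρ := fun c ρ =>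
    pairing_smul_left c v ρ
  rcases hs0.lt_or_eq with hneg | hzero
  · -- A separating hyperplane that is not vertical is the graph of an affine minorant of `F`.
    have hnorm : ∀ x y : ℝ, (-s)⁻¹ * (x + s * y) = (-s)⁻¹ * x - y := fun x y => by
      rw [mul_add, inv_neg, neg_mul s⁻¹ (s * y), inv_mul_cancel_left₀ hneg.ne, sub_eq_add_neg]
    have := coe_sub_le_biconj h0 (w := (-s)⁻¹ • v) (r := (-s)⁻¹ * u) (fun ρ t hρ => by
      rw [hsmul]
      have h1 := mul_lt_mul_of_pos_left (hE ρ t hρ) (inv_pos.2 (neg_pos.2 hneg))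
      rw [hnorm] at h1
      linarith) μ
    refine absurd (h.trans_le' this) (not_lt.2 (EReal.coe_le_coe_iff.2 ?_))
    rw [hsmul]
    have h1 := mul_lt_mul_of_pos_left huf (inv_pos.2 (neg_pos.2 hneg))
    rw [hnorm] at h1
    linarith
  · -- A vertical one separates `μ` from the domain of `F`; arbitrarily steep affine minorants
    -- result, because `F` is non-negative.
    rw [hzero, zero_mul, add_zero] at huf
    have hgap : 0 < pairing v μ - u := sub_pos.2 huf
    set c : ℝ := max (a / (pairing v μ - u)) 0 with hcdef
    have hc0 : 0 ≤ c := le_max_right _ _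
    have := coe_sub_le_biconj h0 (w := c • v) (r := c * u) (fun ρ t hρ => by
      have h1 := hE ρ t hρ
      rw [hzero, zero_mul, add_zero] at h1
      have h2 : (0 : ℝ) ≤ t := by exact_mod_cast (h0 ρ).trans hρ
      rw [hsmul]
      nlinarith) μ
    refine absurd (h.trans_le' this) (not_lt.2 (EReal.coe_le_coe_iff.2 ?_))
    rw [hsmul, ← mul_sub]
    calc a = a / (pairing v μ - u) * (pairing v μ - u) := (div_mul_cancel₀ _ hgap.ne').symm
      _ ≤ c * (pairing v μ - u) := by gcongr; exact le_max_left _ _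

/-- On bounded sets of measures, convergence on a dense sequence of test functions suffices. -/
theorem weakStarTendsto_of_dense {w : ℕ → C₀(Space d, ℝ)} (hw : DenseRange w) {μs : ℕ → Meas d}
    {μ : Meas d} (hs : ∀ n, IsSubProb (μs n))
    (h : ∀ i, Tendsto (fun n => pairing (w i) (μs n)) atTop (𝓝 (pairing (w i) μ))) :
    WeakStarTendsto μs μ := by
  intro v
  rw [Metric.tendsto_atTop]
  intro ε hε
  set C : ℝ := 1 + μ.variation.real Set.univ with hC
  have hC0 : 0 < C := by positivity
  obtain ⟨i, hi⟩ := hw.exists_dist_lt v (show 0 < ε / (2 * C) by positivity)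
  rw [dist_eq_norm] at hi
  obtain ⟨n₀, hn₀⟩ := Metric.tendsto_atTop.1 (h i) (ε / 2) (by positivity)
  refine ⟨n₀, fun n hn => ?_⟩
  have h1 := hn₀ n hn
  have hsub : ∀ ρ : Meas d, pairing v ρ = pairing (v - w i) ρ + pairing (w i) ρ := fun ρ => by
    simp [pairing_eq_pairingBilin]
  have h2 : |pairing (v - w i) (μs n)| ≤ ‖v - w i‖ * 1 := by
    refine (abs_pairing_le _ _).trans ?_
    gcongr
    exact ENNReal.toReal_mono ENNReal.one_ne_top (hs n).variation_univ_le
  have h3 := abs_pairing_le (v - w i) μ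
  have h4 : ‖v - w i‖ * C < ε / 2 := by
    calc _ < ε / (2 * C) * C := by gcongr
      _ = ε / 2 := by field_simp
  rw [Real.dist_eq] at h1 ⊢
  rw [hsub (μs n), hsub μ]
  rw [hC, mul_add] at h4
  rw [abs_le] at h2 h3
  rw [abs_lt] at h1 ⊢
  constructor <;> linarith

/-- Any value strictly above the biconjugate bounds the lower limit of `F` along some weakly* convergent
sequence in its domain. -/
theorem exists_seq_of_biconj_lt {F : Meas d → EReal} (h0 : ∀ μ, 0 ≤ F μ)
    (hdom : ∀ μ, F μ ≠ ⊤ → IsSubProb μ) (hc : IsConvex F) {μ : Meas d} {a : ℝ}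
    (h : biconj F μ < a) :
    ∃ μs : ℕ → Meas d, (∀ n, F (μs n) ≠ ⊤) ∧ WeakStarTendsto μs μ ∧
      liminf (fun n => F (μs n)) atTop ≤ a := by
  obtain ⟨w, hw⟩ := exists_dense_seq_c0 d
  have hpos : ∀ n : ℕ, (0 : ℝ) < 1 / (n + 1) := fun n => by positivity
  choose μs t h1 h2 h3 using fun n : ℕ =>
    exists_epigraph_near h0 hc h (fun i : Fin n => w i) (hpos n)
  have hfin : ∀ n, F (μs n) ≠ ⊤ := fun n => ne_top_of_le_ne_top (EReal.coe_ne_top _) (h1 n)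
  have hlim := tendsto_one_div_add_atTop_nhds_zero_nat (𝕜 := ℝ)
  refine ⟨μs, hfin, weakStarTendsto_of_dense hw (fun n => hdom _ (hfin n)) fun i => ?_, ?_⟩
  · rw [tendsto_iff_dist_tendsto_zero]
    refine squeeze_zero' (.of_forall fun n => dist_nonneg) ?_ hlim
    filter_upwards [eventually_gt_atTop i] with n hn
    exact (h3 n ⟨i, hn⟩).le
  · have hl : Tendsto (fun n : ℕ => ((a + 1 / (n + 1) : ℝ) : EReal)) atTop (𝓝 (a : EReal)) :=
      (continuous_coe_real_ereal.tendsto _).comp (by simpa using hlim.const_add a)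
    rw [← hl.liminf_eq]
    exact liminf_le_liminf (.of_forall fun n => (h1 n).trans (by exact_mod_cast (h2 n).le))

theorem biconj_le_liminf {F : Meas d → EReal} (h0 : ∀ μ, 0 ≤ F μ) {μs : ℕ → Meas d} {μ : Meas d}
    (hlim : WeakStarTendsto μs μ) : biconj F μ ≤ liminf (fun n => F (μs n)) atTop := by
  refine iSup_le fun v => EReal.ge_of_forall_gt_iff_ge.1 fun a ha => ?_
  have h1 : (a : EReal) + conj F v < pairing v μ := EReal.add_lt_of_lt_sub ha
  have h2 : Tendsto (fun n => ((pairing v (μs n) : ℝ) : EReal)) atTop (𝓝 (pairing v μ : ℝ)) :=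
    (continuous_coe_real_ereal.tendsto _).comp (hlim v)
  refine le_liminf_of_le (by isBoundedDefault) ?_
  filter_upwards [h2.eventually_const_lt h1] with n hn
  have h3 : ((pairing v (μs n) : ℝ) : EReal) - F (μs n) ≤ conj F v :=
    le_iSup (fun ρ => ((pairing v ρ : ℝ) : EReal) - F ρ) (μs n)
  have h4 := h0 (μs n)
  generalize F (μs n) = x at h3 h4
  generalize conj F v = c at h3 hn
  induction x with
  | bot => simp at h4
  | top => simp
  | coe x =>
    induction c with
    | bot => exact absurd (le_bot_iff.1 h3) (by rw [← EReal.coe_sub]; exact EReal.coe_ne_bot _)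
    | top => simp at hn
    | coe c =>
      have h5 : a + c < pairing v (μs n) := by exact_mod_cast hn
      have h6 : pairing v (μs n) - x ≤ c := by exact_mod_cast h3
      exact_mod_cast (by linarith : a ≤ x)

/-- The biconjugate of a convex functional is its lower semicontinuous envelope. -/
theorem biconj_eq_lscEnvelope {F : Meas d → EReal} (h0 : ∀ μ, 0 ≤ F μ)
    (hdom : ∀ μ, F μ ≠ ⊤ → IsSubProb μ) (hc : IsConvex F) (μ : Meas d) :
    biconj F μ = lscEnvelope F μ := by
  refine le_antisymm (le_iInf₂ fun μs hμs => biconj_le_liminf h0 hμs) ?_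
  refine EReal.le_of_forall_lt_iff_le.1 fun a ha => ?_
  obtain ⟨μs, -, h2, h3⟩ := exists_seq_of_biconj_lt h0 hdom hc ha
  exact (iInf₂_le μs h2).trans h3

theorem isProb_of_CN_ne_top {ℓ : ℝ≥0 → ℝ≥0∞} {N : ℕ} {μ : Meas d} (h : CN ℓ N μ ≠ ⊤) : IsProb μ := by
  by_contra hμ
  exact h (CN_of_not_isProb hμ)

/-- `C_N` is convex, so its relaxation is the biconjugate, the conjugate of `M_N`. -/
theorem relaxedCN_eq_biconj (ℓ : ℝ≥0 → ℝ≥0∞) (N : ℕ) (μ : Meas d) :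
    relaxedCN ℓ N μ = biconj (CN ℓ N) μ := by
  refine le_antisymm (EReal.le_of_forall_lt_iff_le.1 fun a ha => ?_)
    (le_iInf₂ fun μs hμs => biconj_le_liminf (CN_nonneg ℓ N) hμs.2)
  obtain ⟨μs, h1, h2, h3⟩ := exists_seq_of_biconj_lt (CN_nonneg ℓ N)
    (fun μ hμ => (isProb_of_CN_ne_top hμ).isSubProb) (isConvex_CN ℓ N) ha
  exact (iInf₂_le μs ⟨fun n => isProb_of_CN_ne_top (h1 n), h2⟩).trans h3

/-! ### The limits `M_∞` and `C_∞` -/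

theorem tendsto_MN {ℓ : ℝ≥0 → ℝ≥0∞} (hℓ : Measurable ℓ) (v : C₀(Space d, ℝ)) :
    Tendsto (fun N => MN ℓ N v) atTop (𝓝 (MInf ℓ v)) := by
  have := tendsto_atTop_iInf (antitone_MN hℓ v)
  rwa [← this.limsup_eq] at this

theorem MInf_eq_iInf {ℓ : ℝ≥0 → ℝ≥0∞} (hℓ : Measurable ℓ) (v : C₀(Space d, ℝ)) :
    MInf ℓ v = ⨅ N, MN ℓ N v :=
  (tendsto_atTop_iInf (antitone_MN hℓ v)).limsup_eq

theorem monotone_relaxedCN {ℓ : ℝ≥0 → ℝ≥0∞} (hℓ : Measurable ℓ) (μ : Meas d) :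
    Monotone fun N => relaxedCN ℓ N μ := fun _ _ h =>
  iInf₂_mono fun μs _ => liminf_le_liminf (.of_forall fun n => monotone_CN hℓ (μs n) h)

theorem tendsto_relaxedCN {ℓ : ℝ≥0 → ℝ≥0∞} (hℓ : Measurable ℓ) (μ : Meas d) :
    Tendsto (fun N => relaxedCN ℓ N μ) atTop (𝓝 (CInf ℓ μ)) := by
  have := tendsto_atTop_iSup (monotone_relaxedCN hℓ μ)
  rwa [← this.limsup_eq] at this

theorem coe_lt_coe_sub_comm {a p : ℝ} {x : EReal} :
    (a : EReal) < (p : EReal) - x ↔ x < ((p - a : ℝ) : EReal) := by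
  induction x with
  | bot => exact iff_of_true (EReal.coe_lt_top a) (EReal.bot_lt_coe _)
  | top => simp
  | coe x =>
    rw [← EReal.coe_sub, EReal.coe_lt_coe_iff, EReal.coe_lt_coe_iff]
    exact lt_sub_comm

/-- Suprema commute: the limit of the relaxed costs is the conjugate of the limit of their
conjugates. -/
theorem CInf_eq_dualConj {ℓ : ℝ≥0 → ℝ≥0∞} (hℓ : Measurable ℓ) (μ : Meas d) :
    CInf ℓ μ = dualConj (MInf ℓ) μ := by
  have h1 : CInf ℓ μ = ⨆ N, relaxedCN ℓ N μ :=
    (tendsto_atTop_iSup (monotone_relaxedCN hℓ μ)).limsup_eq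
  simp_rw [h1, relaxedCN_eq_biconj]
  refine le_antisymm (iSup_le fun N => iSup_mono fun v => EReal.sub_le_sub le_rfl ?_)
    (iSup_le fun v => EReal.ge_of_forall_gt_iff_ge.1 fun a ha => ?_)
  · rw [MInf_eq_iInf hℓ]
    exact iInf_le _ N
  · rw [MInf_eq_iInf hℓ, coe_lt_coe_sub_comm] at ha
    obtain ⟨N, hN⟩ := iInf_lt_iff.1 ha
    exact (coe_lt_coe_sub_comm.2 hN).le.trans
      ((le_iSup (fun v => ((pairing v μ : ℝ) : EReal) - conj (CN ℓ N) v) v).trans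
        (le_iSup (fun N => biconj (CN ℓ N) μ) N))

theorem conj_D_le_MInf {ℓ : ℝ≥0 → ℝ≥0∞} (hℓ : Measurable ℓ) (v : C₀(Space d, ℝ)) :
    conj (D ℓ) v ≤ MInf ℓ v := by
  rw [MInf_eq_iInf hℓ]
  exact le_iInf fun N => conj_D_le_MN hℓ N v

theorem MInf_nonneg {ℓ : ℝ≥0 → ℝ≥0∞} (hd : 1 ≤ d) (hm : Measurable ℓ) (hℓ : Tendsto ℓ atTop (𝓝 0))
    (v : C₀(Space d, ℝ)) : 0 ≤ MInf ℓ v := by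
  refine ge_of_tendsto (tendsto_MN hm v) ?_
  filter_upwards [eventually_ge_atTop 1] with N hN using MN_nonneg hd hm hℓ hN v

theorem integral_sub_energy_le_conj_D2 (ℓ : ℝ≥0 → ℝ≥0∞) (v : C₀(Space d, ℝ))
    {m : Measure (Space d)} (h : m Set.univ ≤ 1) :
    ((∫ x, v x ∂m : ℝ) : EReal) - (energy ℓ m : EReal) ≤ conj (D2 ℓ) v := by
  have : IsFiniteMeasure m := ⟨h.trans_lt ENNReal.one_lt_top⟩
  refine le_trans (le_of_eq ?_) (le_iSup _ m.toSignedMeasure)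
  rw [D2_of_isSubProb (isSubProb_toSignedMeasure m h), pairing_toSignedMeasure,
    Measure.variation_toSignedMeasure]

theorem energy_eq_iSup_truncation {ℓ : ℝ≥0 → ℝ≥0∞} (hℓ : Measurable ℓ) (m : Measure (Space d)) :
    energy ℓ m = ⨆ k : ℕ, energy (fun r => min (ℓ r) k) m := by
  have hsup : ∀ c : ℝ≥0∞, c = ⨆ k : ℕ, min c k := fun c => by
    rw [← inf_iSup_eq, ENNReal.iSup_natCast, inf_top_eq]
  calc energy ℓ m = ∫⁻ p, ⨆ k : ℕ, min (ℓ ‖p.1 - p.2‖₊) k ∂(m.prod m) :=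
        lintegral_congr fun p => hsup _
    _ = _ := lintegral_iSup (fun k => by fun_prop)
        fun i j hij p => min_le_min_left _ (by exact_mod_cast hij)

/-- Vague limits of empirical measures of nearly optimal configurations are competitors for the
conjugate of `D₂`. Truncating the cost makes the diagonal terms of the energy of an empirical
measure negligible. -/
theorem MInf_le_conj_D2 {ℓ : ℝ≥0 → ℝ≥0∞} (hℓ : LowerSemicontinuous ℓ) (v : C₀(Space d, ℝ)) :
    MInf ℓ v ≤ conj (D2 ℓ) v := by
  refine EReal.ge_of_forall_gt_iff_ge.1 fun a ha => ?_
  have hN : ∀ n : ℕ, (a : EReal) < MN ℓ (n + 1) v := fun n => by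
    rw [MInf_eq_iInf hℓ.measurable] at ha
    exact ha.trans_le (iInf_le _ _)
  choose x hx using fun n => exists_config_of_lt_MN (Nat.le_add_left 1 n) (hN n)
  have hprob : ∀ n, IsProbabilityMeasure (empirical (x n)) := fun n =>
    isProbabilityMeasure_empirical (Nat.le_add_left 1 n) _
  have hle : ∀ n, empirical (x n) Set.univ ≤ 1 := fun n => prob_le_one
  obtain ⟨m, hm, φ, hφ, hlim⟩ := exists_subseq_vagueTendsto hle
  have hap : a ≤ ∫ y, v y ∂m := by
    refine ge_of_tendsto (hlim v) (.of_forall fun n => ?_)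
    exact (sub_pos.1 (ENNReal.ofReal_pos.1 (pos_of_gt (hx (φ n))))).le
  have hk : ∀ k : ℕ, energy (fun r => min (ℓ r) k) m ≤ ENNReal.ofReal (∫ y, v y ∂m - a) := fun k => by
    have hℓk : LowerSemicontinuous fun r => min (ℓ r) (k : ℝ≥0∞) :=
      hℓ.inf lowerSemicontinuous_const
    have h1 : Tendsto (fun n => ENNReal.ofReal (∫ y, v y ∂(empirical (x (φ n))) - a)
        + (k : ℝ≥0∞) / ((φ n + 1 : ℕ) : ℝ≥0∞)) atTop
        (𝓝 (ENNReal.ofReal (∫ y, v y ∂m - a) + 0)) := by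
      refine ((ENNReal.continuous_ofReal.tendsto _).comp ((hlim v).sub_const a)).add ?_
      have : Tendsto (fun N : ℕ => (k : ℝ≥0∞) / (N : ℝ≥0∞)) atTop (𝓝 0) := by
        simpa using ENNReal.Tendsto.const_div ENNReal.tendsto_nat_nhds_top
          (.inr (ENNReal.natCast_ne_top k))
      exact this.comp ((tendsto_add_atTop_nat 1).comp hφ.tendsto_atTop)
    rw [add_zero] at h1
    refine (energy_le_liminf hℓk (fun n => hle (φ n)) hm hlim).trans ?_
    rw [← h1.liminf_eq]
    refine liminf_le_liminf (.of_forall fun n => ?_)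
    refine (energy_empirical_le hℓk.measurable (Nat.le_add_left 1 (φ n)) _).trans ?_
    gcongr
    · refine le_trans ?_ (hx (φ n)).le
      unfold cost
      gcongr
      exact min_le_left _ _
    · exact min_le_right _ _
  refine (coe_le_coe_sub_of_le hap ?_).trans (integral_sub_energy_le_conj_D2 ℓ v hm)
  rw [energy_eq_iSup_truncation hℓ.measurable]
  exact iSup_le hk

theorem conj_D2_le_conj_D {ℓ : ℝ≥0 → ℝ≥0∞} (hd : 1 ≤ d) (hm : Measurable ℓ)
    (hℓ : Tendsto ℓ atTop (𝓝 0)) (hD : ∃ μ : Meas d, D ℓ μ < ⊤) (v : C₀(Space d, ℝ)) :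
    conj (D2 ℓ) v ≤ conj (D ℓ) v := by
  obtain ⟨σ, hσ⟩ := hD
  have hp : IsProb σ := by
    by_contra h
    simp [D_of_not_isProb h] at hσ
  have := hp.isProbabilityMeasure
  rw [D_of_isProb hp] at hσ
  refine iSup_le fun μ => ?_
  by_cases h : IsSubProb μ
  · rw [D2_of_isSubProb h, pairing_eq_integral h.1]
    exact integral_sub_energy_le_conj_D_of_le_one hd hm hℓ v (σ := σ.variation)
      (fun h => by simp [h] at hσ) h.variation_univ_le
  · simp [D2_of_not_isSubProb h]

/-- If no probability has finite energy, `D₂` is the convex indicator of `0`. -/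
theorem D2_of_D_eq_top {ℓ : ℝ≥0 → ℝ≥0∞} (hD : ∀ μ : Meas d, D ℓ μ = ⊤) {μ : Meas d}
    (hμ : μ ≠ 0) : D2 ℓ μ = ⊤ := by
  by_cases h : IsSubProb μ
  · rw [D2, if_pos h, hD]
    refine EReal.mul_top_of_pos ?_
    have h0 : μ Set.univ ≠ 0 := fun h0 => hμ (by
      have : μ.variation = 0 := by
        rw [← Measure.measure_univ_eq_zero, variation_univ h.1, h0, ENNReal.ofReal_zero]
      simpa using this)
    exact_mod_cast sq_pos_of_ne_zero h0
  · exact D2_of_not_isSubProb h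

theorem D2_zero (ℓ : ℝ≥0 → ℝ≥0∞) : D2 ℓ (0 : Meas d) = 0 := by
  rw [D2_of_isSubProb ⟨le_rfl, by simp⟩]
  simp [energy]

theorem conj_D2_le_zero {ℓ : ℝ≥0 → ℝ≥0∞} (hD : ∀ μ : Meas d, D ℓ μ = ⊤) (v : C₀(Space d, ℝ)) :
    conj (D2 ℓ) v ≤ 0 := iSup_le fun μ => by
  by_cases hμ : μ = 0
  · simp [hμ, D2_zero, pairing_eq_pairingBilin]
  · simp [D2_of_D_eq_top hD hμ]

theorem MInf_eq_conj_D {ℓ : ℝ≥0 → ℝ≥0∞} (hd : 1 ≤ d) (hℓ : StandingAssumptions ℓ)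
    (hD : ∃ μ : Meas d, D ℓ μ < ⊤) (v : C₀(Space d, ℝ)) : MInf ℓ v = conj (D ℓ) v :=
  le_antisymm ((MInf_le_conj_D2 hℓ.lsc v).trans
    (conj_D2_le_conj_D hd hℓ.lsc.measurable hℓ.tendsto_zero hD v))
    (conj_D_le_MInf hℓ.lsc.measurable v)

/-- In terms of `D₂` the formula needs no finiteness: if `D` is identically `⊤`, both sides vanish. -/
theorem MInf_eq_conj_D2 {ℓ : ℝ≥0 → ℝ≥0∞} (hd : 1 ≤ d) (hℓ : StandingAssumptions ℓ)
    (v : C₀(Space d, ℝ)) : MInf ℓ v = conj (D2 ℓ) v := by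
  refine le_antisymm (MInf_le_conj_D2 hℓ.lsc v) ?_
  by_cases hD : ∃ μ : Meas d, D ℓ μ < ⊤
  · rw [MInf_eq_conj_D hd hℓ hD]
    exact conj_D2_le_conj_D hd hℓ.lsc.measurable hℓ.tendsto_zero hD v
  · push Not at hD
    exact (conj_D2_le_zero (fun μ => top_le_iff.1 (hD μ)) v).trans
      (MInf_nonneg hd hℓ.lsc.measurable hℓ.tendsto_zero v)

/-! ### Lower semicontinuity of the energies -/

theorem isSubProb_of_D2_ne_top {ℓ : ℝ≥0 → ℝ≥0∞} {μ : Meas d} (h : D2 ℓ μ ≠ ⊤) : IsSubProb μ := by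
  by_contra hμ
  exact h (D2_of_not_isSubProb hμ)

theorem D2_nonneg (ℓ : ℝ≥0 → ℝ≥0∞) (μ : Meas d) : 0 ≤ D2 ℓ μ := by
  by_cases h : IsSubProb μ
  · rw [D2_of_isSubProb h]; exact EReal.coe_ennreal_nonneg _
  · simp [D2_of_not_isSubProb h]

/-- Sequential weak* lower semicontinuity of `D₂` on all finite signed measures. -/
theorem D2_le_liminf {ℓ : ℝ≥0 → ℝ≥0∞} (hℓ : LowerSemicontinuous ℓ) {μs : ℕ → Meas d} {μ : Meas d}
    (hlim : WeakStarTendsto μs μ) : D2 ℓ μ ≤ liminf (fun n => D2 ℓ (μs n)) atTop := by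
  refine EReal.le_of_forall_lt_iff_le.1 fun a ha => ?_
  obtain ⟨φ, hφ, hφa⟩ := extraction_of_frequently_atTop (frequently_lt_of_liminf_lt (by isBoundedDefault) ha)
  have hs : ∀ n, IsSubProb (μs (φ n)) := fun n => isSubProb_of_D2_ne_top (hφa n).ne_top
  have hlim' : WeakStarTendsto (fun n => μs (φ n)) μ := fun v => (hlim v).comp hφ.tendsto_atTop
  have hμ := isSubProb_of_weakStarTendsto hs hlim'
  have hE : ∀ n, 0 ≤ a ∧ energy ℓ (μs (φ n)).variation ≤ ENNReal.ofReal a := fun n => by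
    rw [← coe_ennreal_le_coe_iff, ← D2_of_isSubProb (hs n)]
    exact (hφa n).le
  rw [D2_of_isSubProb hμ, coe_ennreal_le_coe_iff]
  refine ⟨(hE 0).1, ?_⟩
  refine (energy_le_liminf hℓ (fun n => (hs n).variation_univ_le) hμ.variation_univ_le
    (vagueTendsto_variation (fun n => (hs n).1) hμ.1 hlim')).trans ?_
  refine (liminf_le_liminf (.of_forall fun n => (hE n).2)).trans_eq ?_
  simp

theorem lscEnvelope_le (F : Meas d → EReal) (μ : Meas d) : lscEnvelope F μ ≤ F μ :=
  (iInf₂_le (fun _ => μ) fun _ => tendsto_const_nhds).trans_eq (by simp)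

theorem lscEnvelope_D2 {ℓ : ℝ≥0 → ℝ≥0∞} (hℓ : LowerSemicontinuous ℓ) (μ : Meas d) :
    lscEnvelope (D2 ℓ) μ = D2 ℓ μ :=
  le_antisymm (lscEnvelope_le _ μ) (le_iInf₂ fun _ h => D2_le_liminf hℓ h)

/-- Weak* limits that are probabilities have lost no mass, so relaxation does not lower `D` there. -/
theorem lscEnvelope_D_of_isProb {ℓ : ℝ≥0 → ℝ≥0∞} (hℓ : LowerSemicontinuous ℓ) {μ : Meas d}
    (hμ : IsProb μ) : lscEnvelope (D ℓ) μ = D ℓ μ := by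
  refine le_antisymm (lscEnvelope_le _ μ) (le_iInf₂ fun μs h => ?_)
  rw [← D2_of_isProb hμ]
  exact (D2_le_liminf hℓ h).trans (liminf_le_liminf (.of_forall fun n => D2_le_D ℓ (μs n)))

theorem isProb_of_D_ne_top {ℓ : ℝ≥0 → ℝ≥0∞} {μ : Meas d} (h : D ℓ μ ≠ ⊤) : IsProb μ := by
  by_contra hμ
  exact h (D_of_not_isProb hμ)

theorem isConvex_D2_of_D_eq_top {ℓ : ℝ≥0 → ℝ≥0∞} (hD : ∀ μ : Meas d, D ℓ μ = ⊤) :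
    IsConvex (D2 ℓ (d := d)) := by
  have hset : {p : Meas d × ℝ | D2 ℓ p.1 ≤ (p.2 : EReal)} = {0} ×ˢ Set.Ici 0 := by
    ext ⟨μ, t⟩
    by_cases hμ : μ = 0
    · simp [hμ, D2_zero]
    · simp [hμ, D2_of_D_eq_top hD hμ]
  rw [IsConvex, hset]
  exact (convex_singleton 0).prod (convex_Ici 0)

theorem CInf_eq_biconj_D2 {ℓ : ℝ≥0 → ℝ≥0∞} (hd : 1 ≤ d) (hℓ : StandingAssumptions ℓ) (μ : Meas d) :
    CInf ℓ μ = biconj (D2 ℓ) μ := by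
  rw [CInf_eq_dualConj hℓ.lsc.measurable, biconj]
  congr 1
  exact funext fun v => MInf_eq_conj_D2 hd hℓ v

theorem CInf_eq_biconj_D {ℓ : ℝ≥0 → ℝ≥0∞} (hd : 1 ≤ d) (hℓ : StandingAssumptions ℓ)
    (hD : ∃ μ : Meas d, D ℓ μ < ⊤) (μ : Meas d) : CInf ℓ μ = biconj (D ℓ) μ := by
  rw [CInf_eq_dualConj hℓ.lsc.measurable, biconj]
  congr 1
  exact funext fun v => MInf_eq_conj_D hd hℓ hD v

theorem CInf_eq_D2_of_isConvex {ℓ : ℝ≥0 → ℝ≥0∞} (hd : 1 ≤ d) (hℓ : StandingAssumptions ℓ)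
    (hc : IsConvex (D2 ℓ (d := d))) (μ : Meas d) : CInf ℓ μ = D2 ℓ μ := by
  rw [CInf_eq_biconj_D2 hd hℓ, biconj_eq_lscEnvelope (D2_nonneg ℓ)
    (fun _ => isSubProb_of_D2_ne_top) hc, lscEnvelope_D2 hℓ.lsc]

theorem CInf_eq_lscEnvelope_D {ℓ : ℝ≥0 → ℝ≥0∞} (hd : 1 ≤ d) (hℓ : StandingAssumptions ℓ)
    (hc : IsConvex (D ℓ (d := d))) (hD : ∃ μ : Meas d, D ℓ μ < ⊤) (μ : Meas d) :
    CInf ℓ μ = lscEnvelope (D ℓ) μ := by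
  rw [CInf_eq_biconj_D hd hℓ hD, biconj_eq_lscEnvelope
    (fun μ => (D2_nonneg ℓ μ).trans (D2_le_D ℓ μ)) (fun _ h => (isProb_of_D_ne_top h).isSubProb) hc]

/-- If `D` is identically `⊤`, then `D₂` is convex, and the conclusion follows from that case. -/
theorem CInf_eq_D_of_isConvex {ℓ : ℝ≥0 → ℝ≥0∞} (hd : 1 ≤ d) (hℓ : StandingAssumptions ℓ)
    (hc : IsConvex (D ℓ (d := d))) {μ : Meas d} (hμ : IsProb μ) : CInf ℓ μ = D ℓ μ := by
  by_cases hD : ∃ μ : Meas d, D ℓ μ < ⊤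
  · rw [CInf_eq_lscEnvelope_D hd hℓ hc hD, lscEnvelope_D_of_isProb hℓ.lsc hμ]
  · push Not at hD
    rw [CInf_eq_D2_of_isConvex hd hℓ (isConvex_D2_of_D_eq_top fun μ => top_le_iff.1 (hD μ)),
      D2_of_isProb hμ]

/-! ### The dual formula as an integral of an extended real valued function -/

/-- The identity `f = f⁺ - f⁻` for `f = w - c`, written without subtraction so that it survives
`c = ⊤`. -/
theorem toENNReal_sub_add (w : ℝ) (c : ℝ≥0∞) :
    ((w : EReal) - (c : EReal)).toENNReal + c + ENNReal.ofReal (-w)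
      = (-((w : EReal) - (c : EReal))).toENNReal + ENNReal.ofReal w := by
  induction c with
  | top => simp
  | coe c =>
    have : ((c : ℝ≥0∞) : EReal) = ((c : ℝ) : EReal) := rfl
    rw [this, ← EReal.coe_sub, ← EReal.coe_neg, EReal.toENNReal_of_ne_top (EReal.coe_ne_top _),
      EReal.toENNReal_of_ne_top (EReal.coe_ne_top _), EReal.toReal_coe, EReal.toReal_coe,
      ← ENNReal.ofReal_coe_nnreal]
    have hmax : ∀ r : ℝ, ENNReal.ofReal r = ENNReal.ofReal (max r 0) := fun r => by simp
    have hc : (0 : ℝ) ≤ c := c.2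
    rw [hmax (w - c), hmax (-w), hmax (-(w - c)), hmax w, ← ENNReal.ofReal_add (by simp) hc,
      ← ENNReal.ofReal_add (by positivity) (by simp), ← ENNReal.ofReal_add (by simp) (by simp)]
    congr 1
    grind

/-- The bounded part of the integrand is integrable, so only the energy can be infinite. -/
theorem extIntegral_eq {ℓ : ℝ≥0 → ℝ≥0∞} (hℓ : Measurable ℓ) (v : C₀(Space d, ℝ))
    (m : Measure (Space d)) [IsProbabilityMeasure m] :
    extIntegral (m.prod m)
        (fun p => (((v p.1 + v p.2) / 2 : ℝ) : EReal) - (ℓ ‖p.1 - p.2‖₊ : EReal))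
      = ((∫ x, v x ∂m : ℝ) : EReal) - (energy ℓ m : EReal) := by
  set w : Space d × Space d → ℝ := fun p => (v p.1 + v p.2) / 2 with hw
  have hvm : Measurable v := (map_continuous v).measurable
  have hwm : Measurable w := by fun_prop
  have h1 : Integrable (fun p : Space d × Space d => v p.1) (m.prod m) :=
    (integrable_c0 v m).comp_fst m
  have h2 : Integrable (fun p : Space d × Space d => v p.2) (m.prod m) :=
    (integrable_c0 v m).comp_snd m
  have hwi : Integrable w (m.prod m) := (h1.add h2).div_const 2
  have hwv : ∫ p, w p ∂(m.prod m) = ∫ x, v x ∂m := by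
    simp only [hw]
    rw [integral_div, integral_add h1 h2, integral_fun_fst, integral_fun_snd]
    simp
  set A := ∫⁻ p, ((w p : EReal) - (ℓ ‖p.1 - p.2‖₊ : EReal)).toENNReal ∂(m.prod m)
  set B := ∫⁻ p, (-((w p : EReal) - (ℓ ‖p.1 - p.2‖₊ : EReal))).toENNReal ∂(m.prod m)
  set U := ∫⁻ p, ENNReal.ofReal (w p) ∂(m.prod m)
  set V := ∫⁻ p, ENNReal.ofReal (-w p) ∂(m.prod m)
  have hU : U ≠ ⊤ := hwi.lintegral_lt_top.ne
  have hV : V ≠ ⊤ := hwi.neg.lintegral_lt_top.ne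
  have hid : A + energy ℓ m + V = B + U := by
    rw [energy, ← lintegral_add_right _ (by fun_prop), ← lintegral_add_right _ (by fun_prop),
      ← lintegral_add_right _ (by fun_prop)]
    exact lintegral_congr fun p => toENNReal_sub_add _ _
  have hA : A ≠ ⊤ := by
    refine ne_top_of_le_ne_top hU (lintegral_mono fun p => ?_)
    have : ((w p : EReal) - (ℓ ‖p.1 - p.2‖₊ : EReal)).toENNReal ≤ (w p : EReal).toENNReal :=
      EReal.toENNReal_le_toENNReal (by
        simpa using EReal.sub_le_sub (le_refl (w p : EReal)) (EReal.coe_ennreal_nonneg (ℓ ‖p.1 - p.2‖₊)))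
    simpa [EReal.toENNReal_of_ne_top] using this
  have hreal : ∫ p, w p ∂(m.prod m) = U.toReal - V.toReal :=
    integral_eq_lintegral_pos_part_sub_lintegral_neg_part hwi
  change (A : EReal) - (B : EReal) = _
  rw [← hwv, hreal]
  have hAB : energy ℓ m = ⊤ ↔ B = ⊤ := by
    constructor
    · intro h
      by_contra hB
      rw [h, add_top, top_add] at hid
      exact ENNReal.add_ne_top.2 ⟨hB, hU⟩ hid.symm
    · intro h
      by_contra hE
      rw [h, top_add] at hid
      exact ENNReal.add_ne_top.2 ⟨ENNReal.add_ne_top.2 ⟨hA, hE⟩, hV⟩ hid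
  by_cases hE : energy ℓ m = ⊤
  · simp [hAB.1 hE, hE]
  · have hB : B ≠ ⊤ := fun h => hE (hAB.2 h)
    have hid' := congrArg ENNReal.toReal hid
    rw [ENNReal.toReal_add (ENNReal.add_ne_top.2 ⟨hA, hE⟩) hV, ENNReal.toReal_add hA hE,
      ENNReal.toReal_add hB hU] at hid'
    have hcoe : ∀ c : ℝ≥0∞, c ≠ ⊤ → (c : EReal) = ((c.toReal : ℝ) : EReal) := fun c hc =>
      (EReal.coe_toReal (by simpa using hc) (by simp)).symm.trans (by simp)
    rw [hcoe A hA, hcoe B hB, hcoe _ hE, ← EReal.coe_sub, ← EReal.coe_sub, EReal.coe_eq_coe_iff]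
    linarith

theorem conj_D_eq_iSup_extIntegral {ℓ : ℝ≥0 → ℝ≥0∞} (hℓ : Measurable ℓ) (v : C₀(Space d, ℝ)) :
    conj (D ℓ) v = ⨆ ρ : ProbabilityMeasure (Space d),
      extIntegral ((ρ : Measure (Space d)).prod (ρ : Measure (Space d)))
        (fun p => (((v p.1 + v p.2) / 2 : ℝ) : EReal) - (ℓ ‖p.1 - p.2‖₊ : EReal)) := by
  simp_rw [extIntegral_eq hℓ]
  refine le_antisymm (iSup_le fun μ => ?_) (iSup_le fun ρ => integral_sub_energy_le_conj_D ℓ v ρ)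
  by_cases h : IsProb μ
  · rw [D_of_isProb h, pairing_eq_integral h.1]
    exact le_iSup (fun ρ : ProbabilityMeasure (Space d) =>
      ((∫ x, v x ∂(ρ : Measure (Space d)) : ℝ) : EReal) - (energy ℓ (ρ : Measure (Space d)) : EReal))
      ⟨μ.variation, h.isProbabilityMeasure⟩
  · simp [D_of_not_isProb h]

theorem MN_le_MInf_add {ℓ : ℝ≥0 → ℝ≥0∞} (hℓ : Measurable ℓ) {K : ℝ≥0} (hK : ∀ r, ℓ r ≤ K)
    (v : C₀(Space d, ℝ)) {N : ℕ} (hN : 1 ≤ N) :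
    MN ℓ N v ≤ MInf ℓ v +
      ((1 / (N : ℝ) * ((⨆ r, ℓ r).toReal + ⨆ x, max (v x) 0) : ℝ) : EReal) := by
  have hsup : (⨆ r, ℓ r) ≠ ⊤ := ne_top_of_le_ne_top ENNReal.coe_ne_top (iSup_le hK)
  have h0 : ℓ 0 ≠ ⊤ := ne_top_of_le_ne_top ENNReal.coe_ne_top (hK 0)
  refine (MN_le_conj_D_add hℓ h0 hN v).trans (add_le_add (conj_D_le_MInf hℓ v) ?_)
  rw [EReal.coe_le_coe_iff, one_div, div_eq_inv_mul]
  have h1 : (ℓ 0).toReal ≤ (⨆ r, ℓ r).toReal := ENNReal.toReal_mono hsup (le_iSup ℓ 0)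
  have h2 : 0 ≤ ⨆ x, max (v x) 0 := Real.iSup_nonneg fun x => le_max_right _ _
  gcongr
  linarith

end MultiMarginal
end

theorem mainTheorem1 (d : ℕ) (hd : 1 ≤ d) (ℓ : ℝ≥0 → ℝ≥0∞)
    (hℓ : MultiMarginal.StandingAssumptions ℓ) :
    -- the limits defining `M_∞` and `C_∞` exist
    (∀ v : C₀(MultiMarginal.Space d, ℝ),
      Tendsto (fun N => MultiMarginal.MN ℓ N v) atTop (𝓝 (MultiMarginal.MInf ℓ v))) ∧
    (∀ μ : MultiMarginal.Meas d,
      Tendsto (fun N => MultiMarginal.relaxedCN ℓ N μ) atTop (𝓝 (MultiMarginal.CInf ℓ μ))) ∧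
    -- (i) the dual formula, when `D` is not identically `+∞`
    ((∃ μ : MultiMarginal.Meas d, MultiMarginal.D ℓ μ < ⊤) →
      (∀ v : C₀(MultiMarginal.Space d, ℝ),
        MultiMarginal.MInf ℓ v = MultiMarginal.conj (MultiMarginal.D ℓ) v) ∧
      (∀ v : C₀(MultiMarginal.Space d, ℝ),
        MultiMarginal.MInf ℓ v =
          ⨆ ρ : ProbabilityMeasure (MultiMarginal.Space d),
            MultiMarginal.extIntegral
              ((ρ : Measure (MultiMarginal.Space d)).prod (ρ : Measure (MultiMarginal.Space d)))
              (fun p => (((v p.1 + v p.2) / 2 : ℝ) : EReal) - (ℓ ‖p.1 - p.2‖₊ : EReal)))) ∧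
    -- (i) the rate of convergence for a bounded cost
    ((∃ K : ℝ≥0, ∀ r, ℓ r ≤ K) →
      ∀ (v : C₀(MultiMarginal.Space d, ℝ)) (N : ℕ), 1 ≤ N →
        MultiMarginal.MInf ℓ v ≤ MultiMarginal.MN ℓ N v ∧
        MultiMarginal.MN ℓ N v ≤ MultiMarginal.MInf ℓ v +
          ((1 / (N : ℝ) * ((⨆ r, ℓ r).toReal + ⨆ x, max (v x) 0) : ℝ) : EReal)) ∧
    -- (ii) the duality relations
    (∀ μ : MultiMarginal.Meas d,
      MultiMarginal.CInf ℓ μ = MultiMarginal.biconj (MultiMarginal.D2 ℓ) μ) ∧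
    ((∃ μ : MultiMarginal.Meas d, MultiMarginal.D ℓ μ < ⊤) →
      ∀ μ : MultiMarginal.Meas d,
        MultiMarginal.CInf ℓ μ = MultiMarginal.biconj (MultiMarginal.D ℓ) μ) ∧
    -- (ii) consequences of the convexity of `D`
    (MultiMarginal.IsConvex (MultiMarginal.D ℓ (d := d)) →
      ((∃ μ : MultiMarginal.Meas d, MultiMarginal.D ℓ μ < ⊤) →
        ∀ μ : MultiMarginal.Meas d,
          MultiMarginal.CInf ℓ μ = MultiMarginal.lscEnvelope (MultiMarginal.D ℓ) μ) ∧
      (∀ μ : MultiMarginal.Meas d, MultiMarginal.IsProb μ →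
        MultiMarginal.CInf ℓ μ = MultiMarginal.D ℓ μ)) ∧
    -- (ii) consequence of the convexity of `D₂`
    (MultiMarginal.IsConvex (MultiMarginal.D2 ℓ (d := d)) →
      ∀ μ : MultiMarginal.Meas d, MultiMarginal.CInf ℓ μ = MultiMarginal.D2 ℓ μ) := by

  have hm := hℓ.lsc.measurable
  exact ⟨MultiMarginal.tendsto_MN hm, MultiMarginal.tendsto_relaxedCN hm,
    fun hD => ⟨MultiMarginal.MInf_eq_conj_D hd hℓ hD, fun v =>
      (MultiMarginal.MInf_eq_conj_D hd hℓ hD v).trans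
        (MultiMarginal.conj_D_eq_iSup_extIntegral hm v)⟩,
    fun ⟨_, hK⟩ v N hN => ⟨(MultiMarginal.MInf_eq_iInf hm v).trans_le (iInf_le _ N),
      MultiMarginal.MN_le_MInf_add hm hK v hN⟩,
    MultiMarginal.CInf_eq_biconj_D2 hd hℓ,
    MultiMarginal.CInf_eq_biconj_D hd hℓ,
    fun hc => ⟨MultiMarginal.CInf_eq_lscEnvelope_D hd hℓ hc,
      fun _ hμ => MultiMarginal.CInf_eq_D_of_isConvex hd hℓ hc hμ⟩,
    MultiMarginal.CInf_eq_D2_of_isConvex hd hℓ⟩
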